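/- A \emph{network} on $n$ nodes $V=\{1,\dots,n\}$ consists of non-negative rational costs $c_u$, demands $d_v$ and connection qualities $p_{v,u}$ ($u,v\in V$). If $A\subseteq V$ is the set of nodes sharing a file, a node $u\in A$ sees the demand $\mathrm{load}_A(u)=\sum_{v} \frac{d_v\,p_{v,u}}{\sum_{w\in A}p_{v,w}}$, where terms with $p_{v,u}=0$ count as $0$. In the \emph{Seed Set Process} with seed set $S\subseteq V$, the payment offered to $u$ is $C_u=c_u\sum_v d_v$, and tradeoff factors $\lambda_u$ are drawn independently and uniformly from $[0,1]$. Initially exactly the nodes of $S$ share. In every round, if $A$ is the set of nodes sharing so far, all nodes decide simultaneously: a node $u\in S$ always shares, and a node $u\notin S$ shares if and only if its utility $\lambda_u C_u-c_u\,\mathrm{load}_{A\cup\{u\}}(u)$ is positive. The set of sharing nodes becomes stationary after at most $n$ rounds; let $\sigma(S)$ be the expected number of nodes sharing at the end. \textbf{Corollary.} For every $\epsilon>0$ (and every $c\in\mathbb N$) there is a randomized polynomial-time algorithm which, given a network on $n$ nodes and an integer $0\le k\le n$, always outputs a set $\hat S\subseteq V$ with $|\hat S|=k$, such that with probability at least $1-2^{-cn}$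 over the random bits of the algorithm $$\sigma(\hat S)\;\ge\;\Bigl(1-\frac1e-\epsilon\Bigr)\max_{T\subseteq V,\ |T|\le k}\sigma(T).$$ Here the algorithm is a program, depending only on $\epsilon$ and $c$, for a random access machine with logarithmic cost. The input lists $n$, $k$ and the numerators and denominators of all $c_u,d_v,p_{v,u}$ in binary. There is a polynomial $q$, depending only on $\epsilon$ and $c$, such that on inputs of bit length $L$ the algorithm is supplied with $q(L)$ independent uniform random bits and always halts within time $q(L)$. -/

import Mathlib

namespace SeedSet

/-! ### The sharing process and the Seed Set Process -/

/-- The parameters of a peer-to-peer network with node set `V`: the cost of each node per unit of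
demand served, the demand originating at each node, and the connection qualities; the larger
`quality v u`, the larger the fraction of the demand of `v` that is served by `u`. -/
structure Network (V : Type*) where
  cost : V → ℚ≥0
  demand : V → ℚ≥0
  quality : V → V → ℚ≥0

namespace Network

variable {V : Type*} [Fintype V] [DecidableEq V]

/-- The demand that `u` sees when `A` is the set of sharing nodes. A node `v` with
`quality v u = 0` contributes `0` (also when nobody in `A` serves `v`). -/
noncomputable def load (N : Network V) (A : Finset V) (u : V) : ℝ :=
  ∑ v, (N.demand v : ℝ) * (N.quality v u : ℝ) / ∑ w ∈ A, (N.quality v w : ℝ)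

/-- The payment offered to `u` in the Seed Set Model. -/
noncomputable def payment (N : Network V) (u : V) : ℝ :=
  (N.cost u : ℝ) * ∑ v, (N.demand v : ℝ)

/-- The utility of `u` for sharing together with the nodes of `A`, when `lam u` is its tradeoff
factor between money and bandwidth. -/
noncomputable def utility (N : Network V) (lam : V → ℝ) (A : Finset V) (u : V) : ℝ :=
  lam u * N.payment u - (N.cost u : ℝ) * N.load (insert u A) u

open Classical in
/-- One round: every node decides simultaneously, given that the nodes of `A` shared in the
previous round; seed nodes always share, other nodes share if this has positive utility. -/
noncomputable def step (N : Network V) (S : Finset V) (lam : V → ℝ) (A : Finset V) : Finset V :=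
  S ∪ Finset.univ.filter (fun u => 0 < N.utility lam A u)

/-- The set of sharing nodes at the end of the process with seed set `S`. By `step_finalSet`, the
process is in equilibrium after at most `Fintype.card V` rounds. -/
noncomputable def finalSet (N : Network V) (S : Finset V) (lam : V → ℝ) : Finset V :=
  (N.step S lam)^[Fintype.card V] S

theorem load_anti (N : Network V) {A B : Finset V} (h : A ⊆ B) {u : V} (hu : u ∈ A) :
    N.load B u ≤ N.load A u := by
  unfold load
  refine Finset.sum_le_sum fun v _ => ?_
  have h0 : ∀ w, (0 : ℝ) ≤ (N.quality v w : ℝ) := fun w => by positivity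
  rcases (h0 u).eq_or_lt with h1 | h1
  · simp [← h1]
  · refine div_le_div_of_nonneg_left (by positivity) ?_ ?_
    · exact h1.trans_le (Finset.single_le_sum (fun w _ => h0 w) hu)
    · exact Finset.sum_le_sum_of_subset_of_nonneg h (fun w _ _ => h0 w)

theorem step_mono (N : Network V) (S : Finset V) (lam : V → ℝ) : Monotone (N.step S lam) := by
  intro A B h u hu
  simp only [step, Finset.mem_union, Finset.mem_filter, Finset.mem_univ, true_and] at hu ⊢
  refine hu.imp_right fun hu => hu.trans_le ?_
  have := N.load_anti (Finset.insert_subset_insert u h) (Finset.mem_insert_self u A)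
  unfold utility
  gcongr

/-- The final set is an equilibrium of the process. -/
theorem step_finalSet (N : Network V) (S : Finset V) (lam : V → ℝ) :
    N.step S lam (N.finalSet S lam) = N.finalSet S lam := by
  have hS : S ≤ N.step S lam S := Finset.subset_union_left
  have hm : Monotone fun t => (N.step S lam)^[t] S :=
    (N.step_mono S lam).monotone_iterate_of_le_map hS
  have key : ∀ t, t ≤ ((N.step S lam)^[t] S).card ∨
      N.step S lam ((N.step S lam)^[t] S) = (N.step S lam)^[t] S := by
    intro t
    induction t with
    | zero => exact Or.inl (Nat.zero_le _)
    | succ t ih =>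
      have hsub := hm (Nat.le_succ t)
      simp only [Nat.succ_eq_add_one, Function.iterate_succ_apply'] at hsub ⊢
      by_cases he : N.step S lam ((N.step S lam)^[t] S) = (N.step S lam)^[t] S
      · right; rw [he, he]
      · left
        have h1 := ih.resolve_right he
        have h2 := Finset.card_lt_card (lt_of_le_of_ne hsub (Ne.symm he))
        omega
  rcases key (Fintype.card V) with h | h
  · have hu : N.finalSet S lam = Finset.univ :=
      (Finset.card_eq_iff_eq_univ _).1 (le_antisymm (Finset.card_le_univ _) h)
    have hsub := hm (Nat.le_succ (Fintype.card V))
    simp only [Nat.succ_eq_add_one, Function.iterate_succ_apply'] at hsub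
    change N.finalSet S lam ≤ N.step S lam (N.finalSet S lam) at hsub
    rw [hu] at hsub ⊢
    exact Finset.univ_subset_iff.1 hsub
  · exact h

/-- The expected number of nodes sharing in the end, when the tradeoff factors are independent
and uniform on `[0, 1]`. -/
noncomputable def expectedSpread (N : Network V) (S : Finset V) : ℝ :=
  ∫ lam : V → ℝ, ((N.finalSet S lam).card : ℝ)
    ∂(MeasureTheory.Measure.pi
      (fun _ : V => MeasureTheory.volume.restrict (Set.Icc (0 : ℝ) 1)))

end Network

/-! ### Random access machines with logarithmic cost

Programs are structured programs working on finitely many arrays of natural numbers. Every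
operation is charged according to the bit lengths of the numbers and addresses it handles. -/

/-- A memory: `s a i` is the content of cell `i` of array `a`. -/
abbrev Memory := ℕ → ℕ → ℕ

/-- The arithmetic operations: `sub` is truncated, `x / 0 = 0`, `x % 0 = x`, and `lt` yields
`1` (true) or `0` (false). -/
inductive Op
  | add | sub | mul | div | mod | lt

def Op.eval : Op → ℕ → ℕ → ℕ
  | .add, x, y => x + y
  | .sub, x, y => x - y
  | .mul, x, y => x * y
  | .div, x, y => x / y
  | .mod, x, y => x % y
  | .lt, x, y => if x < y then 1 else 0

/-- Expressions: constants, array cells (the address is itself computed), operations. -/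
inductive Expr
  | const (x : ℕ)
  | get (a : ℕ) (i : Expr)
  | op (o : Op) (e f : Expr)

def Expr.eval (s : Memory) : Expr → ℕ
  | .const x => x
  | .get a i => s a (i.eval s)
  | .op o e f => o.eval (e.eval s) (f.eval s)

/-- The time to evaluate an expression. A binary operation on numbers with `p` and `q` bits is
charged `(p + 1) * (q + 1)`, the number of bit operations of the school methods. -/
def Expr.time (s : Memory) : Expr → ℕ
  | .const x => x.size + 1
  | .get a i => i.time s + (i.eval s).size + (s a (i.eval s)).size + 1
  | .op _ e f => e.time s + f.time s + ((e.eval s).size + 1) * ((f.eval s).size + 1)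

inductive Prog
  | skip
  | assign (a : ℕ) (i e : Expr)
  | seq (P Q : Prog)
  | ite (e : Expr) (P Q : Prog)
  | while (e : Expr) (P : Prog)

/-- `Exec P s t s'`: started in memory `s`, the program `P` halts after time exactly `t` in memory
`s'`. Tests succeed on nonzero values. -/
inductive Exec : Prog → Memory → ℕ → Memory → Prop
  | skip (s : Memory) : Exec .skip s 1 s
  | assign (a : ℕ) (i e : Expr) (s : Memory) :
      Exec (.assign a i e) s
        (i.time s + e.time s + (i.eval s).size + (e.eval s).size + 1)
        (Function.update s a (Function.update (s a) (i.eval s) (e.eval s)))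
  | seq {P Q : Prog} {s s' s'' : Memory} {t t' : ℕ} :
      Exec P s t s' → Exec Q s' t' s'' → Exec (.seq P Q) s (t + t') s''
  | ite_true {e : Expr} {P Q : Prog} {s s' : Memory} {t : ℕ} :
      e.eval s ≠ 0 → Exec P s t s' → Exec (.ite e P Q) s (e.time s + 1 + t) s'
  | ite_false {e : Expr} {P Q : Prog} {s s' : Memory} {t : ℕ} :
      e.eval s = 0 → Exec Q s t s' → Exec (.ite e P Q) s (e.time s + 1 + t) s'
  | while_true {e : Expr} {P : Prog} {s s' s'' : Memory} {t t' : ℕ} :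
      e.eval s ≠ 0 → Exec P s t s' → Exec (.while e P) s' t' s'' →
      Exec (.while e P) s (e.time s + 1 + t + t') s''
  | while_false {e : Expr} {P : Prog} {s : Memory} :
      e.eval s = 0 → Exec (.while e P) s (e.time s + 1) s

/-- Programs are deterministic: running time and final memory are unique. -/
theorem Exec.unique {P : Prog} {s s₁ s₂ : Memory} {t₁ t₂ : ℕ}
    (h₁ : Exec P s t₁ s₁) (h₂ : Exec P s t₂ s₂) : t₁ = t₂ ∧ s₁ = s₂ := by
  induction h₁ generalizing t₂ s₂ with
  | skip s => cases h₂; exact ⟨rfl, rfl⟩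
  | assign a i e s => cases h₂; exact ⟨rfl, rfl⟩
  | seq _ _ ih ih' =>
    cases h₂ with
    | seq g g' =>
      obtain ⟨rfl, rfl⟩ := ih g
      obtain ⟨rfl, rfl⟩ := ih' g'
      exact ⟨rfl, rfl⟩
  | ite_true h _ ih =>
    cases h₂ with
    | ite_true _ g => obtain ⟨rfl, rfl⟩ := ih g; exact ⟨rfl, rfl⟩
    | ite_false h' _ => exact absurd h' h
  | ite_false h _ ih =>
    cases h₂ with
    | ite_true h' _ => exact absurd h h'
    | ite_false _ g => obtain ⟨rfl, rfl⟩ := ih g; exact ⟨rfl, rfl⟩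
  | while_true h _ _ ih ih' =>
    cases h₂ with
    | while_true _ g g' =>
      obtain ⟨rfl, rfl⟩ := ih g
      obtain ⟨rfl, rfl⟩ := ih' g'
      exact ⟨rfl, rfl⟩
    | while_false h' => exact absurd h' h
  | while_false h =>
    cases h₂ with
    | while_true h' _ _ => exact absurd h h'
    | while_false _ => exact ⟨rfl, rfl⟩

/-- The memory at the start of a randomized computation: array `0` holds the random bits `r`,
array `a + 2` holds the `a`-th list of the input, and all other cells are `0`. -/
def initialMemory (input : List (List ℕ)) {m : ℕ} (r : Fin m → Bool) : Memory
  | 0, i => if h : i < m then (r ⟨i, h⟩).toNat else 0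
  | 1, _ => 0
  | a + 2, i => (input.getD a []).getD i 0

/-- The set of nodes described by the output array, which is array `1`. -/
def outputSet (n : ℕ) (s : Memory) : Finset (Fin n) :=
  Finset.univ.filter (fun u => s 1 u ≠ 0)

/-- The length of an input in bits, with one delimiter per number. -/
def inputSize (input : List (List ℕ)) : ℕ :=
  (input.flatten.map (fun x => x.size + 1)).sum

/-- The input describing a network and the size `k` of the seed set: numerators and denominators
of all parameters, the matrix of connection qualities being listed row by row. -/
def encode {n : ℕ} (N : Network (Fin n)) (k : ℕ) : List (List ℕ) :=
  [[n, k],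
    List.ofFn (fun u => (N.cost u).num), List.ofFn (fun u => (N.cost u).den),
    List.ofFn (fun v => (N.demand v).num), List.ofFn (fun v => (N.demand v).den),
    List.ofFn (fun i : Fin (n * n) => (N.quality i.divNat i.modNat).num),
    List.ofFn (fun i : Fin (n * n) => (N.quality i.divNat i.modNat).den)]

end SeedSet

/-!
The expected spread of the Seed Set Process is monotone and submodular, it can be estimated for all
seed sets at once by sampling, and the greedy algorithm tolerates small errors of the estimates.

*Submodularity.* A node responds to the set of sharing nodes by a monotone predicate, a `Response`,
which is random and independent of the responses of the other nodes; the process ends in the least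
stable set containing the seeds, its `spread`. The spread depends on the response of a single node
only through one value of that response (`spread_eq_ite`). Hence the expected size of the spread
depends only on the marginal probabilities of the responses, and changing all of these by at most
`η` changes it by at most `n ^ 2 * η` (`abs_expectedSize_sub_le`). The probability that `u` wants
to share with `A` is a mixture, over the nodes `v`, of the ratios of the total quality of `A` to
that of `A ∪ {u}`. Such a ratio is also the probability that in a weighted sampling without
replacement a node of `A` is drawn before `u` (`isTriggering_ratio`). So the process may be replaced
by one whose responses preserve unions. There the spread of a union of seed sets is the union of the
spreads, and its size is a coverage function, which gives `Network.expectedSpread_union_add_inter`.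

*Sampling.* The tradeoff factors are replaced by numbers with `3 * n + κ` random binary digits, and
the loads by integer approximations, after clearing denominators. By the continuity in the marginals
this changes the expected spread by at most `(1 / 2) ^ κ`. The same `μ * n ^ 3` samples serve for
all seed sets: by a Chernoff bound and a union bound over the `2 ^ n` seed sets all empirical
averages are accurate, except with probability `(1 / 2) ^ (c * n)` (`one_sub_le_card_isAccurate`).

*Greedy maximization.* A greedy set for values with error `δ` loses at most `2 * δ` in each of the
`k` steps, and the optimum is at least `k`, as seeds always share; so these errors cost at most
`2 * δ` times the optimum (`IsGreedy.approx`).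

*Running time.* The predicate `Runs` expresses total correctness of a program, within a time bound
`Prog.cost` that is read off its text: a polynomial in a number `K` that bounds the bit length of
all memory cells and the number of iterations of all loops. It remains to show that a polynomial in
the size of the input can serve as `K`, which is the content of `Greedy.Fits`, and that the program
computes a greedy set (`Greedy.runs_program`).
-/

set_option linter.unusedSectionVars false

namespace SeedSet

open Finset

/-! ### Cascades with monotone responses -/

/-- The response of a node: a monotone predicate, telling for which sets of sharing nodes the
node decides to share as well. -/
abbrev Response (V : Type*) := Finset V →o Prop

section Cascade

variable {V : Type*}

noncomputable instance [Fintype V] : Fintype (Response V) :=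
  have : Finite (Response V) := DFunLike.finite _
  Fintype.ofFinite _

/-- No node outside `B` responds to `B`. -/
def IsStable (R : V → Response V) (B : Finset V) : Prop := ∀ v, R v B → v ∈ B

variable [Fintype V]

open Classical in
/-- The least stable set containing `S`: the set of sharing nodes at the end of the cascade that
starts in `S`. -/
noncomputable def spread (R : V → Response V) (S : Finset V) : Finset V :=
  univ.filter fun u => ∀ B, S ⊆ B → IsStable R B → u ∈ B

theorem subset_spread (R : V → Response V) (S : Finset V) : S ⊆ spread R S := by
  intro u hu
  simp only [spread, mem_filter, mem_univ, true_and]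
  exact fun B hB _ => hB hu

theorem spread_subset {R : V → Response V} {S B : Finset V} (h : S ⊆ B) (hB : IsStable R B) :
    spread R S ⊆ B := by
  intro u hu
  simp only [spread, mem_filter, mem_univ, true_and] at hu
  exact hu B h hB

theorem isStable_spread (R : V → Response V) (S : Finset V) : IsStable R (spread R S) := by
  intro u hu
  simp only [spread, mem_filter, mem_univ, true_and]
  exact fun B h hB => hB u ((R u).monotone (spread_subset h hB) hu)

theorem spread_mono (R : V → Response V) {S T : Finset V} (h : S ⊆ T) :
    spread R S ⊆ spread R T :=
  spread_subset (h.trans (subset_spread R T)) (isStable_spread R T)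

/-- For responses that preserve unions the spread is additive, so that its size is a coverage
function of the seed set. -/
theorem card_spread_union_add_inter [DecidableEq V] {R : V → Response V}
    (hR : ∀ v A B, R v (A ∪ B) → R v A ∨ R v B) (S T : Finset V) :
    (spread R (S ∪ T)).card + (spread R (S ∩ T)).card ≤
      (spread R S).card + (spread R T).card := by
  have h1 : spread R (S ∪ T) ⊆ spread R S ∪ spread R T := by
    refine spread_subset (union_subset_union (subset_spread _ _) (subset_spread _ _)) ?_
    intro v hv
    rcases hR v _ _ hv with h | h
    · exact mem_union_left _ (isStable_spread R S v h)
    · exact mem_union_right _ (isStable_spread R T v h)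
  have h2 : spread R (S ∩ T) ⊆ spread R S ∩ spread R T :=
    subset_inter (spread_mono R inter_subset_left) (spread_mono R inter_subset_right)
  rw [← card_union_add_card_inter (spread R S)]
  exact add_le_add (card_le_card h1) (card_le_card h2)

variable [DecidableEq V]

open Classical in
/-- The response of a single node `u` enters a cascade only through its value at the spread that
arises when `u` never responds. -/
theorem spread_eq_ite (R : V → Response V) (S : Finset V) (u : V) :
    spread R S = if R u (spread (Function.update R u ⊥) S)
      then spread (Function.update R u ⊥) (insert u S)
      else spread (Function.update R u ⊥) S := by
  set R' := Function.update R u ⊥ with hR'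
  have hst : ∀ B, IsStable R B → IsStable R' B := by
    intro B hB v hv
    rcases eq_or_ne v u with rfl | h
    · simp [hR'] at hv
    · exact hB v (by simpa [hR', h] using hv)
  have hle : spread R' S ⊆ spread R S :=
    spread_subset (subset_spread _ _) (hst _ (isStable_spread R S))
  have hst' : ∀ B, IsStable R' B → (R u B → u ∈ B) → IsStable R B := by
    intro B hB hu v hv
    rcases eq_or_ne v u with rfl | h
    · exact hu hv
    · exact hB v (by simpa [hR', h] using hv)
  split_ifs with h
  · apply subset_antisymm
    · refine spread_subset ((subset_insert u S).trans (subset_spread _ _)) ?_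
      exact hst' _ (isStable_spread _ _) fun _ => subset_spread _ _ (mem_insert_self u S)
    · refine spread_subset (insert_subset ?_ (subset_spread _ _)) (hst _ (isStable_spread R S))
      exact isStable_spread R S u ((R u).monotone hle h)
  · exact subset_antisymm (spread_subset (subset_spread _ _)
      (hst' _ (isStable_spread _ _) fun h' => absurd h' h)) hle

theorem notMem_spread_update_bot (R : V → Response V) {S : Finset V} {u : V} (hu : u ∉ S) :
    u ∉ spread (Function.update R u ⊥) S := by
  have h : spread (Function.update R u ⊥) S ⊆
      (spread (Function.update R u ⊥) S).erase u := by
    refine spread_subset (subset_erase.2 ⟨subset_spread _ _, hu⟩) ?_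
    intro v hv
    rcases eq_or_ne v u with rfl | h
    · simp at hv
    · exact mem_erase.2 ⟨h, isStable_spread _ _ v
        ((Function.update R u ⊥ v).monotone (erase_subset _ _) hv)⟩
  exact fun h' => notMem_erase u _ (h h')

/-! ### Independent random responses -/

/-- A probability law on responses, given by its weights. -/
structure IsLaw (w : Response V → ℝ) : Prop where
  nonneg : ∀ R, 0 ≤ w R
  sum_eq_one : ∑ R, w R = 1

open Classical in
/-- The probability that a response with law `w` is positive at `A`. -/
noncomputable def marginal (w : Response V → ℝ) (A : Finset V) : ℝ :=
  ∑ R, w R * if R A then 1 else 0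

/-- The expectation of a function of independent responses, `w v` being the law of the response
of node `v`. -/
noncomputable def expect (w : V → Response V → ℝ) (F : (V → Response V) → ℝ) : ℝ :=
  ∑ R : V → Response V, (∏ v, w v (R v)) * F R

theorem expect_sub (w : V → Response V → ℝ) (F G : (V → Response V) → ℝ) :
    expect w (fun R => F R - G R) = expect w F - expect w G := by
  simp [expect, mul_sub]

theorem expect_mono {w : V → Response V → ℝ} (hw : ∀ v, IsLaw (w v))
    {F G : (V → Response V) → ℝ} (h : ∀ R, (∀ v, w v (R v) ≠ 0) → F R ≤ G R) :
    expect w F ≤ expect w G := by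
  refine sum_le_sum fun R _ => ?_
  by_cases hR : ∀ v, w v (R v) ≠ 0
  · exact mul_le_mul_of_nonneg_left (h R hR) (prod_nonneg fun v _ => (hw v).nonneg _)
  · push Not at hR
    obtain ⟨v, hv⟩ := hR
    rw [prod_eq_zero (f := fun v => w v (R v)) (mem_univ v) hv, zero_mul, zero_mul]

theorem expect_const {w : V → Response V → ℝ} (hw : ∀ v, IsLaw (w v)) (x : ℝ) :
    expect w (fun _ => x) = x := by
  rw [expect, ← sum_mul, ← Fintype.piFinset_univ, ← prod_univ_sum]
  simp [fun v => (hw v).sum_eq_one]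

/-- Conditioning on the responses of all nodes but `u`. -/
theorem expect_update {w : V → Response V → ℝ} (hw : ∀ v, IsLaw (w v)) (u : V)
    {a : Response V → ℝ} (F : (V → Response V) → ℝ) :
    expect (Function.update w u a) F =
      expect w (fun R => ∑ ρ, a ρ * F (Function.update R u ρ)) := by
  have key : ∀ (b : Response V → ℝ) (G : (V → Response V) → ℝ),
      expect (Function.update w u b) G = ∑ y : {v // v ≠ u} → Response V, ∑ ρ,
        b ρ * (∏ v : {v // v ≠ u}, w v (y v)) * G ((Equiv.funSplitAt u _).symm (ρ, y)) := by
    intro b G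
    rw [expect, ← (Equiv.funSplitAt u (Response V)).symm.sum_comp, Fintype.sum_prod_type_right]
    refine sum_congr rfl fun y _ => sum_congr rfl fun ρ _ => ?_
    rw [Fintype.prod_eq_mul_prod_subtype_ne _ u]
    congr 2
    · simp
    · refine prod_congr rfl fun v _ => ?_
      rw [Function.update_of_ne v.2]
      simp [v.2]
  have hs : ∀ (ρ ρ' : Response V) (y : {v // v ≠ u} → Response V),
      Function.update ((Equiv.funSplitAt u _).symm (ρ', y)) u ρ =
        (Equiv.funSplitAt u (Response V)).symm (ρ, y) := by
    intro ρ ρ' y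
    ext v
    rcases eq_or_ne v u with rfl | h
    · simp
    · simp [h]
  have h2 := key (w u) (fun R => ∑ ρ, a ρ * F (Function.update R u ρ))
  rw [Function.update_eq_self] at h2
  rw [h2, key]
  refine sum_congr rfl fun y _ => ?_
  simp only [hs]
  rw [← sum_mul, ← sum_mul, (hw u).sum_eq_one, one_mul, mul_sum]
  exact sum_congr rfl fun ρ _ => by ring

/-- The expected size of a cascade. -/
noncomputable def expectedSize (w : V → Response V → ℝ) (S : Finset V) : ℝ :=
  expect w fun R => ((spread R S).card : ℝ)

theorem abs_expectedSize_update_sub_le {w : V → Response V → ℝ} (hw : ∀ v, IsLaw (w v)) (u : V)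
    {a b : Response V → ℝ} (ha : IsLaw a) (hb : IsLaw b) {η : ℝ}
    (h : ∀ A, u ∉ A → |marginal a A - marginal b A| ≤ η) (S : Finset V) :
    |expectedSize (Function.update w u a) S - expectedSize (Function.update w u b) S| ≤
      Fintype.card V * η := by
  classical
  have hη : 0 ≤ η := (abs_nonneg _).trans (h ∅ (notMem_empty u))
  have hinner : ∀ {a : Response V → ℝ}, IsLaw a → ∀ R : V → Response V,
      ∑ ρ, a ρ * ((spread (Function.update R u ρ) S).card : ℝ) =
        (spread (Function.update R u ⊥) S).card +
          marginal a (spread (Function.update R u ⊥) S) *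
            ((spread (Function.update R u ⊥) (insert u S)).card -
              (spread (Function.update R u ⊥) S).card) := by
    intro a ha R
    have h1 : ((spread (Function.update R u ⊥) S).card : ℝ) =
        ∑ ρ, a ρ * ((spread (Function.update R u ⊥) S).card : ℝ) := by
      rw [← sum_mul, ha.sum_eq_one, one_mul]
    conv_rhs => rw [marginal, sum_mul]; enter [1]; rw [h1]
    rw [← sum_add_distrib]
    refine sum_congr rfl fun ρ _ => ?_
    rw [spread_eq_ite _ S u]
    simp only [Function.update_self, Function.update_idem]
    split_ifs <;> ring
  have hb1 : ∀ R : V → Response V,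
      |∑ ρ, a ρ * ((spread (Function.update R u ρ) S).card : ℝ) -
        ∑ ρ, b ρ * ((spread (Function.update R u ρ) S).card : ℝ)| ≤ Fintype.card V * η := by
    intro R
    rw [hinner ha, hinner hb]
    by_cases hu : u ∈ S
    · rw [insert_eq_of_mem hu]
      simp only [sub_self, mul_zero, add_zero, abs_zero]
      positivity
    · have h1 := h _ (notMem_spread_update_bot R hu)
      have h2 : ((spread (Function.update R u ⊥) S).card : ℝ) ≤
          (spread (Function.update R u ⊥) (insert u S)).card :=
        Nat.cast_le.2 (card_le_card (spread_mono _ (subset_insert u S)))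
      have h3 : ((spread (Function.update R u ⊥) (insert u S)).card : ℝ) ≤ Fintype.card V :=
        Nat.cast_le.2 (card_le_univ _)
      rw [add_sub_add_left_eq_sub, ← sub_mul, abs_mul, mul_comm,
        abs_of_nonneg (sub_nonneg.2 h2)]
      have h4 : (0 : ℝ) ≤ (spread (Function.update R u ⊥) S).card := by positivity
      exact mul_le_mul (by linarith) h1 (abs_nonneg _) (by positivity)
  rw [expectedSize, expectedSize, expect_update hw, expect_update hw, ← expect_sub, abs_le]
  constructor
  · rw [← expect_const hw (-(Fintype.card V * η))]
    exact expect_mono hw fun R _ => (abs_le.1 (hb1 R)).1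
  · rw [← expect_const hw (Fintype.card V * η)]
    exact expect_mono hw fun R _ => (abs_le.1 (hb1 R)).2

/-- The expected size of a cascade depends only on the marginals of the responses, and does so
continuously; the nodes are switched from one law to the other one at a time. -/
theorem abs_expectedSize_sub_le {w w' : V → Response V → ℝ} (hw : ∀ v, IsLaw (w v))
    (hw' : ∀ v, IsLaw (w' v)) {η : ℝ}
    (h : ∀ u A, u ∉ A → |marginal (w u) A - marginal (w' u) A| ≤ η) (S : Finset V) :
    |expectedSize w S - expectedSize w' S| ≤ Fintype.card V * (Fintype.card V * η) := by
  have key : ∀ J : Finset V, |expectedSize w S - expectedSize (J.piecewise w' w) S| ≤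
      J.card * (Fintype.card V * η) := by
    intro J
    induction J using Finset.induction_on with
    | empty => simp
    | insert u J hu ih =>
      have hl : ∀ v, IsLaw (J.piecewise w' w v) := fun v =>
        J.piecewise_cases w' w (fun x => IsLaw x) (hw' v) (hw v)
      have h1 := abs_expectedSize_update_sub_le hl u (hw u) (hw' u) (h u) S
      rw [show Function.update (J.piecewise w' w) u (w u) = J.piecewise w' w by
        conv_rhs => rw [← Function.update_eq_self u (J.piecewise w' w)]
        simp [hu], ← piecewise_insert] at h1
      rw [card_insert_of_notMem hu]
      push_cast
      have := abs_sub_le (expectedSize w S) (expectedSize (J.piecewise w' w) S)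
        (expectedSize ((insert u J).piecewise w' w) S)
      linarith
  have := key univ
  rwa [piecewise_univ, card_univ] at this

end Cascade

/-! ### Triggering laws and submodularity -/

section Trigger

variable {V : Type*} [Fintype V] [DecidableEq V]

/-- `g` is the marginal of a law on responses that preserve unions. -/
def IsTriggering (g : Finset V → ℝ) : Prop :=
  ∃ w : Response V → ℝ, IsLaw w ∧
    (∀ R, w R ≠ 0 → ∀ A B, R (A ∪ B) → R A ∨ R B) ∧ ∀ A, marginal w A = g A

open Classical in
theorem isLaw_single (R : Response V) : IsLaw (Pi.single R (1 : ℝ)) where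
  nonneg R' := by
    rcases eq_or_ne R' R with rfl | h
    · simp
    · simp [h]
  sum_eq_one := by simp

open Classical in
theorem marginal_single (R : Response V) (A : Finset V) :
    marginal (Pi.single R (1 : ℝ)) A = if R A then 1 else 0 := by
  rw [marginal, sum_eq_single R]
  · simp
  · intro R' _ h
    simp [h]
  · simp

theorem isTriggering_zero : IsTriggering (fun _ : Finset V => (0 : ℝ)) := by
  classical
  refine ⟨Pi.single ⊥ 1, isLaw_single _, fun R hR A B h => ?_, fun A => ?_⟩
  · have : R = ⊥ := by by_contra h'; exact hR (Pi.single_eq_of_ne h' _)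
    subst this
    simp at h
  · simp [marginal_single]

theorem isTriggering_one : IsTriggering (fun _ : Finset V => (1 : ℝ)) := by
  classical
  refine ⟨Pi.single ⊤ 1, isLaw_single _, fun R hR A B h => ?_, fun A => ?_⟩
  · have : R = ⊤ := by by_contra h'; exact hR (Pi.single_eq_of_ne h' _)
    subst this
    simp
  · simp [marginal_single]

theorem IsTriggering.sum {ι : Type*} {s : Finset ι} {c : ι → ℝ} {g : ι → Finset V → ℝ}
    (hc : ∀ i ∈ s, 0 ≤ c i) (h1 : ∑ i ∈ s, c i = 1) (hg : ∀ i ∈ s, IsTriggering (g i)) :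
    IsTriggering (fun A => ∑ i ∈ s, c i * g i A) := by
  classical
  choose! w hw hu hm using hg
  refine ⟨fun R => ∑ i ∈ s, c i * w i R, ⟨fun R => ?_, ?_⟩, fun R hR => ?_, fun A => ?_⟩
  · exact sum_nonneg fun i hi => mul_nonneg (hc i hi) ((hw i hi).nonneg R)
  · rw [sum_comm, ← h1]
    refine sum_congr rfl fun i hi => ?_
    rw [← mul_sum, (hw i hi).sum_eq_one, mul_one]
  · obtain ⟨i, hi, h⟩ := exists_ne_zero_of_sum_ne_zero hR
    exact hu i hi R (right_ne_zero_of_mul h)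
  · simp only [marginal, sum_mul]
    rw [sum_comm]
    refine sum_congr rfl fun i hi => ?_
    rw [← hm i hi, marginal, mul_sum]
    exact sum_congr rfl fun R _ => by ring

theorem IsTriggering.ite_mem {g : Finset V → ℝ} (hg : IsTriggering g) (x : V) :
    IsTriggering (fun A => if x ∈ A then 1 else g A) := by
  classical
  obtain ⟨w, hw, hu, hm⟩ := hg
  let φ : Response V → Response V := fun R =>
    ⟨fun A => x ∈ A ∨ R A, fun A B h => Or.imp (fun hx => h hx) (fun hR => R.monotone h hR)⟩
  refine ⟨fun R' => ∑ R with φ R = R', w R, ⟨fun R' => sum_nonneg fun R _ => hw.nonneg R, ?_⟩,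
    fun R' hR' => ?_, fun A => ?_⟩
  · rw [sum_fiberwise, hw.sum_eq_one]
  · obtain ⟨R, hR, h⟩ := exists_ne_zero_of_sum_ne_zero hR'
    obtain rfl := (mem_filter.1 hR).2
    intro A B hAB
    change x ∈ A ∪ B ∨ R (A ∪ B) at hAB
    change (x ∈ A ∨ R A) ∨ (x ∈ B ∨ R B)
    have := hu R h A B
    rw [mem_union] at hAB
    tauto
  · have h1 : marginal (fun R' => ∑ R with φ R = R', w R) A =
        ∑ R, w R * if φ R A then 1 else 0 := by
      rw [marginal, ← sum_fiberwise univ φ fun R => w R * if φ R A then 1 else 0]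
      refine sum_congr rfl fun R' _ => ?_
      rw [sum_mul]
      refine sum_congr rfl fun R hR => ?_
      rw [(mem_filter.1 hR).2]
    have h2 : ∀ R, φ R A ↔ (x ∈ A ∨ R A) := fun R => Iff.rfl
    rw [h1]
    beta_reduce
    split_ifs with hx
    · simp [h2, hx, hw.sum_eq_one]
    · simp only [h2, hx, false_or]
      exact hm A

/-- Drawing nodes without replacement with probabilities proportional to their weights, `p₀` being
the weight of the responding node, the probability that some node of `A` is drawn before the
responding node is the weight of `A` relative to that of `A` and the responding node. -/
theorem isTriggering_ratio {p : V → ℝ} (hp : ∀ v, 0 ≤ p v) {p₀ : ℝ} (hp₀ : 0 < p₀)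
    (W : Finset V) :
    IsTriggering (fun A => (∑ x ∈ W with x ∈ A, p x) / ((∑ x ∈ W with x ∈ A, p x) + p₀)) := by
  induction W using Finset.strongInduction with
  | H W ih =>
    have hP0 : 0 ≤ ∑ x ∈ W, p x := sum_nonneg fun x _ => hp x
    have hP : 0 < (∑ x ∈ W, p x) + p₀ := by linarith
    set P := (∑ x ∈ W, p x) + p₀ with hPdef
    let h : Finset V → Finset V → ℝ := fun W A =>
      (∑ x ∈ W with x ∈ A, p x) / ((∑ x ∈ W with x ∈ A, p x) + p₀)
    let c : Option V → ℝ := fun o => o.elim (p₀ / P) fun x => p x / P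
    let g : Option V → Finset V → ℝ := fun o =>
      o.elim (fun _ => 0) fun x A => if x ∈ A then 1 else h (W.erase x) A
    -- condition on the first node drawn; `none` stands for the responding node
    have key := IsTriggering.sum (s := insertNone W) (c := c) (g := g) ?_ ?_ ?_
    · convert key using 2 with A
      have h1 : ∀ x ∈ W, c (some x) * g (some x) A =
          p x / P * h W A + if x ∈ A then p x / P * (1 - h W A) else 0 := by
        intro x hx
        simp only [c, g, Option.elim_some]
        split_ifs with hxA
        · ring
        · have : (W.erase x).filter (· ∈ A) = W.filter (· ∈ A) := by
            ext y
            simp only [mem_filter, mem_erase]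
            refine ⟨fun hy => ⟨hy.1.2, hy.2⟩, fun hy => ⟨⟨?_, hy.1⟩, hy.2⟩⟩
            rintro rfl
            exact hxA hy.2
          simp [h, this]
      have ha : 0 ≤ ∑ x ∈ W with x ∈ A, p x := sum_nonneg fun x _ => hp x
      rw [sum_insertNone, sum_congr rfl h1, sum_add_distrib, ← sum_filter, ← sum_mul, ← sum_mul,
        ← sum_div, ← sum_div]
      simp only [c, g, Option.elim_none, mul_zero, zero_add, h]
      have hPW : ∑ x ∈ W, p x = P - p₀ := by rw [hPdef]; ring
      rw [hPW]
      have : (∑ x ∈ W with x ∈ A, p x) + p₀ ≠ 0 := by positivity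
      field_simp
      ring
    · intro o _
      cases o with
      | none => exact div_nonneg hp₀.le hP.le
      | some x => exact div_nonneg (hp x) hP.le
    · rw [sum_insertNone]
      simp only [c, Option.elim_none, Option.elim_some]
      rw [← sum_div, ← add_div, add_comm, ← hPdef, div_self hP.ne']
    · intro o ho
      cases o with
      | none => exact isTriggering_zero
      | some x =>
        exact (ih _ (erase_ssubset (by simpa using ho))).ite_mem x

/-- If all marginals are triggering, then the expected size of the cascade is submodular, being
a mixture of coverage functions. -/
theorem expectedSize_union_add_inter {w : V → Response V → ℝ} (hw : ∀ v, IsLaw (w v))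
    {g : V → Finset V → ℝ} (hg : ∀ v, IsTriggering (g v))
    (hm : ∀ v A, v ∉ A → marginal (w v) A = g v A) (S T : Finset V) :
    expectedSize w (S ∪ T) + expectedSize w (S ∩ T) ≤ expectedSize w S + expectedSize w T := by
  choose w' hw' hu hm' using hg
  have heq : expectedSize w = expectedSize w' := by
    ext S
    have := abs_expectedSize_sub_le hw hw' (η := 0)
      (fun u A hA => by rw [hm u A hA, hm', sub_self, abs_zero]) S
    simpa [sub_eq_zero] using this
  rw [heq, ← sub_nonneg]
  have h1 : expectedSize w' S + expectedSize w' T -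
      (expectedSize w' (S ∪ T) + expectedSize w' (S ∩ T)) =
      expect w' fun R => ((spread R S).card : ℝ) - (spread R (S ∪ T)).card -
        ((spread R (S ∩ T)).card - (spread R T).card) := by
    rw [expect_sub, expect_sub, expect_sub]
    simp only [expectedSize]
    ring
  rw [h1, ← expect_const hw' 0]
  refine expect_mono hw' fun R hR => ?_
  have := card_spread_union_add_inter (R := R) (fun v => hu v _ (hR v)) S T
  have h2 : ((spread R (S ∪ T)).card : ℝ) + (spread R (S ∩ T)).card ≤
      (spread R S).card + (spread R T).card := by exact_mod_cast this
  linarith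

theorem expectedSize_mono {w : V → Response V → ℝ} (hw : ∀ v, IsLaw (w v)) :
    Monotone (expectedSize w) := fun _ _ h =>
  expect_mono hw fun R _ => Nat.cast_le.2 (card_le_card (spread_mono R h))

theorem card_le_expectedSize {w : V → Response V → ℝ} (hw : ∀ v, IsLaw (w v)) (S : Finset V) :
    (S.card : ℝ) ≤ expectedSize w S := by
  rw [← expect_const hw S.card]
  exact expect_mono hw fun R _ => Nat.cast_le.2 (card_le_card (subset_spread R S))

end Trigger

/-! ### The Seed Set Process as a cascade -/

section RandomResponse

open MeasureTheory

variable {V : Type*} [Fintype V]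

variable {Ω : Type*} [MeasurableSpace Ω]

theorem measurableSet_response_eq {ρ : Ω → Response V} (hρ : ∀ A, MeasurableSet {x | ρ x A})
    (R : Response V) : MeasurableSet {x | ρ x = R} := by
  classical
  have : {x | ρ x = R} = ⋂ A, {x | ρ x A ↔ R A} := by
    ext x
    simp only [Set.mem_ofPred_eq, Set.mem_iInter]
    refine ⟨fun h A => by rw [h], fun h => OrderHom.ext _ _ (funext fun A => propext (h A))⟩
  rw [this]
  refine MeasurableSet.iInter fun A => ?_
  by_cases hA : R A
  · simpa [hA] using hρ A
  · simp only [hA, iff_false]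
    exact (hρ A).compl

/-- The law of a random response. -/
noncomputable def lawOf (μ : Measure Ω) (ρ : Ω → Response V) (R : Response V) : ℝ :=
  μ.real {x | ρ x = R}

variable {μ : Measure Ω} [IsProbabilityMeasure μ]

theorem marginal_lawOf {ρ : Ω → Response V} (hρ : ∀ A, MeasurableSet {x | ρ x A})
    (A : Finset V) : marginal (lawOf μ ρ) A = μ.real {x | ρ x A} := by
  classical
  have h := sum_measureReal_preimage_singleton (μ := μ) (f := ρ) (univ.filter fun R => R A)
    (fun R _ => measurableSet_response_eq hρ R)
  simp only [marginal, mul_ite, mul_one, mul_zero]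
  rw [← sum_filter]
  refine h.trans ?_
  congr 1
  ext x
  simp

theorem isLaw_lawOf {ρ : Ω → Response V} (hρ : ∀ A, MeasurableSet {x | ρ x A}) :
    IsLaw (lawOf μ ρ) where
  nonneg R := measureReal_nonneg
  sum_eq_one := by
    have h := sum_measureReal_preimage_singleton (μ := μ) (f := ρ) univ
      (fun R _ => measurableSet_response_eq hρ R)
    exact h.trans (by simp)

theorem integral_pi_eq_expect [DecidableEq V] {ρ : V → Ω → Response V}
    (hρ : ∀ v A, MeasurableSet {x | ρ v x A}) (F : (V → Response V) → ℝ) :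
    ∫ ω : V → Ω, F (fun v => ρ v (ω v)) ∂(Measure.pi fun _ => μ) =
      expect (fun v => lawOf μ (ρ v)) F := by
  let _ : MeasurableSpace (Response V) := ⊤
  have hm : ∀ v, Measurable (ρ v) := fun v =>
    measurable_to_countable' fun R => measurableSet_response_eq (hρ v) R
  have : ∀ v, IsProbabilityMeasure (μ.map (ρ v)) := fun v =>
    Measure.isProbabilityMeasure_map (hm v).aemeasurable
  have h1 := Measure.pi_map_pi (μ := fun _ : V => μ) (f := ρ) (fun v => (hm v).aemeasurable)
  have h2 := integral_map (μ := Measure.pi fun _ : V => μ) (φ := fun x v => ρ v (x v)) (f := F)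
    (measurable_pi_lambda _ fun v => (hm v).comp (measurable_pi_apply v)).aemeasurable
    (measurable_of_finite F).aestronglyMeasurable
  rw [← h2, h1, integral_fintype Integrable.of_finite, expect]
  refine sum_congr rfl fun R _ => ?_
  rw [smul_eq_mul, measureReal_def, Measure.pi_singleton, ENNReal.toReal_prod]
  congr 1
  refine prod_congr rfl fun v _ => ?_
  rw [Measure.map_apply (hm v) (MeasurableSet.singleton _)]
  rfl

end RandomResponse

section Network

open MeasureTheory

variable {V : Type*} [Fintype V] [DecidableEq V]

namespace Network

theorem load_nonneg (N : Network V) (A : Finset V) (u : V) : 0 ≤ N.load A u :=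
  sum_nonneg fun v _ => div_nonneg (by positivity) (sum_nonneg fun w _ => by positivity)

/-- The total demand. -/
noncomputable def total (N : Network V) : ℝ := ∑ v, (N.demand v : ℝ)

theorem total_nonneg (N : Network V) : 0 ≤ N.total := sum_nonneg fun v _ => by positivity

theorem load_le_total (N : Network V) {A : Finset V} {u : V} (hu : u ∈ A) :
    N.load A u ≤ N.total := by
  refine sum_le_sum fun v _ => div_le_of_le_mul₀ (sum_nonneg fun w _ => by positivity)
    (by positivity) ?_
  gcongr
  exact single_le_sum (f := fun w => (N.quality v w : ℝ)) (fun w _ => by positivity) hu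

/-- The response of `u` when its tradeoff factor is `x`. -/
noncomputable def response (N : Network V) (u : V) (x : ℝ) : Response V where
  toFun A := 0 < x * N.payment u - (N.cost u : ℝ) * N.load (insert u A) u
  monotone' A B h hA := hA.trans_le <| by
    have := N.load_anti (insert_subset_insert u h) (mem_insert_self u A)
    gcongr

theorem response_iff (N : Network V) (u : V) (x : ℝ) (A : Finset V) :
    N.response u x A ↔ 0 < x * N.payment u - (N.cost u : ℝ) * N.load (insert u A) u := Iff.rfl

theorem finalSet_eq_spread (N : Network V) (S : Finset V) (lam : V → ℝ) :
    N.finalSet S lam = spread (fun u => N.response u (lam u)) S := by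
  have hst : ∀ B, S ⊆ B → IsStable (fun u => N.response u (lam u)) B → N.step S lam B ⊆ B := by
    intro B hB h u hu
    simp only [step, mem_union, mem_filter, mem_univ, true_and] at hu
    rcases hu with hu | hu
    · exact hB hu
    · exact h u hu
  apply subset_antisymm
  · have : ∀ t, (N.step S lam)^[t] S ⊆ spread (fun u => N.response u (lam u)) S := by
      intro t
      induction t with
      | zero => exact subset_spread _ _
      | succ t ih =>
        rw [Function.iterate_succ_apply']
        exact (N.step_mono S lam ih).trans
          (hst _ (subset_spread _ _) (isStable_spread _ _))
    exact this _
  · refine spread_subset ?_ ?_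
    · rw [← step_finalSet]
      exact subset_union_left
    · intro u hu
      rw [← step_finalSet]
      exact mem_union_right _ (mem_filter.2 ⟨mem_univ u, hu⟩)

theorem measurableSet_response (N : Network V) (u : V) (A : Finset V) :
    MeasurableSet {x | N.response u x A} :=
  measurableSet_lt (f := fun _ : ℝ => (0 : ℝ))
    (g := fun x => x * N.payment u - (N.cost u : ℝ) * N.load (insert u A) u)
    measurable_const (by fun_prop)

/-- The law of the response of `u`. -/
noncomputable def law (N : Network V) (u : V) : Response V → ℝ :=
  lawOf (volume.restrict (Set.Icc (0 : ℝ) 1)) (N.response u)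

instance : IsProbabilityMeasure (volume.restrict (Set.Icc (0 : ℝ) 1)) :=
  ⟨by simp⟩

theorem isLaw_law (N : Network V) (u : V) : IsLaw (N.law u) :=
  isLaw_lawOf (N.measurableSet_response u)

theorem expectedSpread_eq (N : Network V) (S : Finset V) :
    N.expectedSpread S = expectedSize N.law S := by
  simp only [expectedSpread, finalSet_eq_spread]
  exact integral_pi_eq_expect (fun v A => N.measurableSet_response v A)
    fun R => ((spread R S).card : ℝ)

/-- The probability that `u` wants to share together with the nodes of `A`. -/
theorem marginal_law (N : Network V) (u : V) (A : Finset V) :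
    marginal (N.law u) A =
      if N.cost u = 0 ∨ N.total = 0 then 0 else 1 - N.load (insert u A) u / N.total := by
  rw [law, marginal_lawOf (μ := volume.restrict (Set.Icc (0 : ℝ) 1)) (N.measurableSet_response u)]
  split_ifs with h
  · have : {x | N.response u x A} = ∅ := by
      ext x
      simp only [Set.mem_ofPred_eq, Set.mem_empty_iff_false, iff_false, response_iff, payment,
        not_lt]
      rcases h with h | h
      · simp [h]
      · have h' : ∑ v, (N.demand v : ℝ) = 0 := h
        rw [h', mul_zero, mul_zero, zero_sub, neg_nonpos]
        exact mul_nonneg (by positivity) (N.load_nonneg _ _)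
    rw [this, measureReal_empty]
  · push Not at h
    have hD : 0 < N.total := lt_of_le_of_ne N.total_nonneg (Ne.symm h.2)
    have hc : (0 : ℝ) < N.cost u := by
      have := pos_iff_ne_zero.2 h.1
      exact_mod_cast this
    have h0 : 0 ≤ N.load (insert u A) u / N.total := div_nonneg (N.load_nonneg _ _) hD.le
    have h1 : N.load (insert u A) u / N.total ≤ 1 :=
      div_le_one_of_le₀ (N.load_le_total (mem_insert_self u A)) hD.le
    have : {x | N.response u x A} ∩ Set.Icc 0 1 = Set.Ioc (N.load (insert u A) u / N.total) 1 := by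
      ext x
      simp only [Set.mem_inter_iff, Set.mem_ofPred_eq, response_iff, Set.mem_Icc, Set.mem_Ioc]
      have : 0 < x * N.payment u - N.cost u * N.load (insert u A) u ↔
          N.load (insert u A) u / N.total < x := by
        rw [div_lt_iff₀ hD, sub_pos, payment, ← total, mul_left_comm, mul_lt_mul_iff_right₀ hc]
      rw [this]
      exact ⟨fun h => ⟨h.1, h.2.2⟩, fun h => ⟨h.1, h0.trans h.1.le, h.2⟩⟩
    rw [measureReal_restrict_apply (N.measurableSet_response u A), this,
      Real.volume_real_Ioc_of_le h1]

/-- Every node responds as if it drew a node `v` with probability proportional to the demand, and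
then drew nodes without replacement according to their connection quality to `v`, until it draws
itself or a sharing node. -/
theorem exists_isTriggering (N : Network V) (u : V) :
    ∃ g, IsTriggering g ∧ ∀ A, u ∉ A → marginal (N.law u) A = g A := by
  by_cases h : N.cost u = 0 ∨ N.total = 0
  · exact ⟨_, isTriggering_zero, fun A _ => by rw [marginal_law, if_pos h]⟩
  have hD : 0 < N.total := lt_of_le_of_ne N.total_nonneg fun h' => h (Or.inr h'.symm)
  let f : V → Finset V → ℝ := fun v A => if N.quality v u = 0 then 1 else
    (∑ x ∈ univ with x ∈ A, (N.quality v x : ℝ)) /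
      ((∑ x ∈ univ with x ∈ A, (N.quality v x : ℝ)) + N.quality v u)
  have hf : ∀ v, IsTriggering (f v) := by
    intro v
    by_cases hv : N.quality v u = 0
    · simpa [f, hv] using isTriggering_one
    · have h0 : (0 : ℝ) < N.quality v u := by exact_mod_cast pos_iff_ne_zero.2 hv
      simpa only [f, hv, if_false] using
        isTriggering_ratio (p := fun x => (N.quality v x : ℝ)) (fun x => by positivity) h0 univ
  refine ⟨_, IsTriggering.sum (s := univ) (c := fun v => (N.demand v : ℝ) / N.total) (g := f)
    (fun v _ => div_nonneg (by positivity) hD.le) ?_ (fun v _ => hf v), fun A hA => ?_⟩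
  · rw [← sum_div, ← total, div_self hD.ne']
  · have h1 : N.total = ∑ v, (N.demand v : ℝ) := rfl
    rw [marginal_law, if_neg h, eq_comm, ← div_self hD.ne']
    nth_rw 2 [h1]
    rw [load, sum_div, sum_div, ← sum_sub_distrib]
    refine sum_congr rfl fun v _ => ?_
    simp only [f, sum_insert hA]
    split_ifs with hv
    · simp [hv]
    · have h0 : (0 : ℝ) < N.quality v u := by exact_mod_cast pos_iff_ne_zero.2 hv
      have h2 : (0 : ℝ) ≤ ∑ x ∈ A, (N.quality v x : ℝ) := sum_nonneg fun x _ => by positivity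
      simp only [filter_mem_eq_inter, univ_inter]
      field_simp
      ring

theorem expectedSpread_union_add_inter (N : Network V) (S T : Finset V) :
    N.expectedSpread (S ∪ T) + N.expectedSpread (S ∩ T) ≤
      N.expectedSpread S + N.expectedSpread T := by
  choose g hg hm using N.exists_isTriggering
  simp only [expectedSpread_eq]
  exact expectedSize_union_add_inter N.isLaw_law hg hm S T

theorem expectedSpread_mono (N : Network V) : Monotone N.expectedSpread := by
  intro S T h
  simp only [expectedSpread_eq]
  exact expectedSize_mono N.isLaw_law h

theorem card_le_expectedSpread (N : Network V) (S : Finset V) :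
    (S.card : ℝ) ≤ N.expectedSpread S := by
  rw [expectedSpread_eq]
  exact card_le_expectedSize N.isLaw_law S

end Network

end Network

/-! ### Greedy maximization with noisy values -/

section Greedy

variable {V : Type*} [DecidableEq V] {α : Type*} [LE α]

/-- `IsGreedy f i S`: the set `S` arises from `∅` by adding `i` nodes, each of which maximizes the
value of `f` among all new nodes. -/
inductive IsGreedy (f : Finset V → α) : ℕ → Finset V → Prop
  | zero : IsGreedy f 0 ∅
  | succ {i : ℕ} {S : Finset V} {x : V} : IsGreedy f i S → x ∉ S →
      (∀ y, y ∉ S → f (insert y S) ≤ f (insert x S)) → IsGreedy f (i + 1) (insert x S)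

theorem IsGreedy.card_eq {f : Finset V → α} {i : ℕ} {S : Finset V} (h : IsGreedy f i S) :
    S.card = i := by
  induction h with
  | zero => rfl
  | succ _ hx _ ih => rw [card_insert_of_notMem hx, ih]

theorem IsGreedy.map {β : Type*} [LE β] {f : Finset V → α} {g : α → β}
    (hg : ∀ x y, x ≤ y → g x ≤ g y) {i : ℕ} {S : Finset V} (h : IsGreedy f i S) :
    IsGreedy (fun A => g (f A)) i S := by
  induction h with
  | zero => exact .zero
  | succ _ hx hm ih => exact .succ ih hx fun y hy => hg _ _ (hm y hy)

theorem le_add_sum_of_submodular {σ : Finset V → ℝ}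
    (hsub : ∀ S T, σ (S ∪ T) + σ (S ∩ T) ≤ σ S + σ T) (S T : Finset V) (hST : Disjoint S T) :
    σ (S ∪ T) ≤ σ S + ∑ u ∈ T, (σ (insert u S) - σ S) := by
  induction T using Finset.induction_on with
  | empty => simp
  | insert u T hu ih =>
    rw [disjoint_insert_right] at hST
    have h1 := hsub (S ∪ T) (insert u S)
    have h2 : (S ∪ T) ∪ insert u S = S ∪ insert u T := by
      ext v
      simp only [mem_union, mem_insert]
      tauto
    have h3 : (S ∪ T) ∩ insert u S = S := by
      ext v
      simp only [mem_union, mem_insert, mem_inter]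
      refine ⟨?_, fun h => ⟨Or.inl h, Or.inr h⟩⟩
      rintro ⟨h | h, rfl | h'⟩ <;> first | assumption | exact absurd h hu
    rw [h2, h3] at h1
    rw [sum_insert hu]
    linarith [ih hST.2]

variable {σ f : Finset V → ℝ} {δ : ℝ}

/-- Every greedy step closes a `1 / k` fraction of the gap to the optimum, up to the error made by
comparing two noisy values. -/
theorem IsGreedy.sub_le (hmono : Monotone σ)
    (hsub : ∀ S T, σ (S ∪ T) + σ (S ∩ T) ≤ σ S + σ T) (h0 : 0 ≤ σ ∅)
    (hf : ∀ S, |f S - σ S| ≤ δ) {k : ℕ} {T : Finset V} (hT : T.card ≤ k) {i : ℕ} {S : Finset V}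
    (h : IsGreedy f i S) (hi : i ≤ k) :
    σ T - σ S ≤ (1 - 1 / (k : ℝ)) ^ i * σ T + 2 * δ * i := by
  induction h with
  | zero => simpa using h0
  | @succ i S x hS hx hm ih =>
    have hk : (0 : ℝ) < k := by exact_mod_cast (show 0 < k by omega)
    have hk1 : (1 : ℝ) ≤ k := by exact_mod_cast (show 1 ≤ k by omega)
    have hδ : 0 ≤ δ := (abs_nonneg _).trans (hf ∅)
    have ih := ih (by omega)
    set g := σ (insert x S) - σ S + 2 * δ with hg
    have hg0 : 0 ≤ g := by
      have := hmono (subset_insert x S)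
      linarith
    have h1 : σ T ≤ σ S + k * g := by
      calc σ T ≤ σ (S ∪ (T \ S)) := hmono (by
              rw [union_sdiff_self_eq_union]
              exact subset_union_right)
        _ ≤ σ S + ∑ u ∈ T \ S, (σ (insert u S) - σ S) :=
              le_add_sum_of_submodular hsub _ _ disjoint_sdiff
        _ ≤ σ S + ∑ u ∈ T \ S, g := by
              gcongr with u hu
              have := hm u (mem_sdiff.1 hu).2
              have h2 := abs_le.1 (hf (insert u S))
              have h3 := abs_le.1 (hf (insert x S))
              linarith
        _ ≤ σ S + k * g := by
              rw [sum_const, nsmul_eq_mul]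
              gcongr
              exact (card_le_card sdiff_subset).trans hT
    have h2 : (σ T - σ S) / k ≤ g := by
      rw [div_le_iff₀ hk]
      linarith
    have h3 : σ T - σ (insert x S) ≤ (1 - 1 / (k : ℝ)) * (σ T - σ S) + 2 * δ := by
      have : (1 - 1 / (k : ℝ)) * (σ T - σ S) = (σ T - σ S) - (σ T - σ S) / k := by ring
      rw [this]
      linarith
    have h4 : 0 ≤ 1 - 1 / (k : ℝ) := by
      rw [sub_nonneg]
      exact (div_le_one hk).2 hk1
    have h5 : 1 - 1 / (k : ℝ) ≤ 1 := by
      have : 0 ≤ 1 / (k : ℝ) := by positivity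
      linarith
    have h6 := mul_le_mul_of_nonneg_left ih h4
    have h7 : (1 - 1 / (k : ℝ)) * (2 * δ * i) ≤ 2 * δ * i :=
      mul_le_of_le_one_left (by positivity) h5
    push_cast
    rw [pow_succ]
    linarith

theorem IsGreedy.approx [Fintype V] (hmono : Monotone σ)
    (hsub : ∀ S T, σ (S ∪ T) + σ (S ∩ T) ≤ σ S + σ T) (hcard : ∀ S, (S.card : ℝ) ≤ σ S)
    (hf : ∀ S, |f S - σ S| ≤ δ) {k : ℕ} (hk : k ≤ Fintype.card V) {S : Finset V}
    (h : IsGreedy f k S) {T : Finset V} (hT : T.card ≤ k) :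
    (1 - 1 / Real.exp 1 - 2 * δ) * σ T ≤ σ S := by
  have hδ : 0 ≤ δ := (abs_nonneg _).trans (hf ∅)
  obtain ⟨T', hTT', -, hT'⟩ := exists_subsuperset_card_eq (subset_univ T) hT (by simpa using hk)
  have h0 : ∀ S, 0 ≤ σ S := fun S => le_trans (by positivity) (hcard S)
  have hk1 := h.sub_le hmono hsub (h0 ∅) hf hT'.le le_rfl
  have hσk : (k : ℝ) ≤ σ T' := hT' ▸ hcard T'
  have hσ := hmono hTT'
  rcases Nat.eq_zero_or_pos k with rfl | hk0
  · have hS := card_eq_zero.1 h.card_eq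
    obtain rfl : T = ∅ := card_eq_zero.1 (Nat.le_zero.1 hT)
    rw [hS]
    refine mul_le_of_le_one_left (h0 _) ?_
    have : 0 ≤ 1 / Real.exp 1 := by positivity
    linarith
  · have h1 : (1 - 1 / (k : ℝ)) ^ k ≤ 1 / Real.exp 1 := by
      have h2 := Real.one_sub_div_pow_le_exp_neg (n := k) (t := 1) (by exact_mod_cast hk0)
      rwa [Real.exp_neg, ← one_div] at h2
    have h2 := mul_le_mul_of_nonneg_right h1 (h0 T')
    have h3 := mul_le_mul_of_nonneg_left hσk (show 0 ≤ 2 * δ by positivity)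
    have h4 : (1 - 1 / Real.exp 1 - 2 * δ) * σ T' ≤ σ S := by linarith
    rcases le_total 0 (1 - 1 / Real.exp 1 - 2 * δ) with h5 | h5
    · exact (mul_le_mul_of_nonneg_left hσ h5).trans h4
    · exact (mul_nonpos_of_nonpos_of_nonneg h5 (h0 T)).trans (h0 S)

end Greedy

/-! ### Concentration of empirical averages -/

section Concentration

variable {Ω : Type*} [Fintype Ω] [Nonempty Ω]

theorem sum_exp_le {Y : Ω → ℝ} (hY : ∀ x, |Y x| ≤ 1) (h0 : ∑ x, Y x = 0) {t : ℝ} (ht0 : 0 ≤ t)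
    (ht1 : t ≤ 1) : ∑ x, Real.exp (t * Y x) ≤ Fintype.card Ω * Real.exp (t ^ 2) := by
  have h1 : ∀ x, Real.exp (t * Y x) ≤ 1 + t * Y x + t ^ 2 := by
    intro x
    have h2 : |t * Y x| ≤ t := by
      rw [abs_mul, abs_of_nonneg ht0]
      exact mul_le_of_le_one_right ht0 (hY x)
    have h3 := (abs_le.1 (Real.abs_exp_sub_one_sub_id_le (h2.trans ht1))).2
    have h4 : (t * Y x) ^ 2 ≤ t ^ 2 := sq_le_sq.2 (by rwa [abs_of_nonneg ht0])
    linarith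
  calc ∑ x, Real.exp (t * Y x) ≤ ∑ x, (1 + t * Y x + t ^ 2) := sum_le_sum fun x _ => h1 x
    _ = Fintype.card Ω * (t ^ 2 + 1) := by
      rw [sum_add_distrib, sum_add_distrib, ← mul_sum, h0]
      simp only [sum_const, card_univ, nsmul_eq_mul]
      ring
    _ ≤ _ := by
      gcongr
      exact Real.add_one_le_exp _

/-- A Chernoff bound for `M` independent uniform samples from `Ω`. -/
theorem card_deviation_le {Y : Ω → ℝ} (hY : ∀ x, |Y x| ≤ 1) (h0 : ∑ x, Y x = 0) {δ : ℝ}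
    (hδ0 : 0 ≤ δ) (hδ1 : δ ≤ 2) (M : ℕ) :
    ((univ.filter fun ω : Fin M → Ω => M * δ < ∑ t, Y (ω t)).card : ℝ) ≤
      Real.exp (-(M * δ ^ 2 / 4)) * (Fintype.card Ω : ℝ) ^ M := by
  have h1 := sum_exp_le hY h0 (t := δ / 2) (by positivity) (by linarith)
  calc ((univ.filter fun ω : Fin M → Ω => M * δ < ∑ t, Y (ω t)).card : ℝ)
      = ∑ ω : Fin M → Ω with M * δ < ∑ t, Y (ω t), (1 : ℝ) := by simp
    _ ≤ ∑ ω : Fin M → Ω with M * δ < ∑ t, Y (ω t),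
          Real.exp (-(M * δ ^ 2 / 2)) * ∏ t, Real.exp (δ / 2 * Y (ω t)) := by
        refine sum_le_sum fun ω hω => ?_
        rw [← Real.exp_sum, ← Real.exp_add, ← mul_sum]
        refine Real.one_le_exp ?_
        have := mul_le_mul_of_nonneg_left (mem_filter.1 hω).2.le (show 0 ≤ δ / 2 by positivity)
        linarith
    _ ≤ ∑ ω : Fin M → Ω, Real.exp (-(M * δ ^ 2 / 2)) * ∏ t, Real.exp (δ / 2 * Y (ω t)) :=
        sum_le_sum_of_subset_of_nonneg (filter_subset _ _) fun _ _ _ => by positivity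
    _ = Real.exp (-(M * δ ^ 2 / 2)) * (∑ x, Real.exp (δ / 2 * Y x)) ^ M := by
        rw [← mul_sum, Fintype.sum_pow]
    _ ≤ Real.exp (-(M * δ ^ 2 / 2)) * (Fintype.card Ω * Real.exp ((δ / 2) ^ 2)) ^ M := by
        gcongr
    _ = Real.exp (-(M * δ ^ 2 / 4)) * (Fintype.card Ω : ℝ) ^ M := by
        rw [mul_pow, ← Real.exp_nat_mul, mul_left_comm, ← Real.exp_add, mul_comm]
        congr 2
        ring

/-- Simultaneous concentration of a finite family of empirical means. -/
theorem card_exists_deviation_le {ι : Type*} [Fintype ι] {X : ι → Ω → ℝ}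
    (hX0 : ∀ i x, 0 ≤ X i x) (hX1 : ∀ i x, X i x ≤ 1) {δ : ℝ} (hδ0 : 0 ≤ δ) (hδ1 : δ ≤ 2)
    (M : ℕ) :
    ((univ.filter fun ω : Fin M → Ω =>
      ∃ i, M * δ < |∑ t, X i (ω t) - M * ((∑ x, X i x) / Fintype.card Ω)|).card : ℝ) ≤
      Fintype.card ι * (2 * Real.exp (-(M * δ ^ 2 / 4))) * (Fintype.card Ω : ℝ) ^ M := by
  classical
  let μ : ι → ℝ := fun i => (∑ x, X i x) / Fintype.card Ω
  have hc : (0 : ℝ) < Fintype.card Ω := by exact_mod_cast Fintype.card_pos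
  have hs : ∀ i, ∑ x, (X i x - μ i) = 0 := by
    intro i
    rw [sum_sub_distrib, sum_const, card_univ, nsmul_eq_mul, mul_div_cancel₀ _ hc.ne', sub_self]
  have hμ0 : ∀ i, 0 ≤ μ i := fun i => div_nonneg (sum_nonneg fun x _ => hX0 i x) hc.le
  have hμ1 : ∀ i, μ i ≤ 1 := by
    intro i
    refine (div_le_one hc).2 ?_
    calc ∑ x, X i x ≤ ∑ x : Ω, (1 : ℝ) := sum_le_sum fun x _ => hX1 i x
      _ = Fintype.card Ω := by simp
  have ha : ∀ i x, |X i x - μ i| ≤ 1 := fun i x => abs_le.2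
    ⟨by linarith [hX0 i x, hμ1 i], by linarith [hX1 i x, hμ0 i]⟩
  have hsub : (univ.filter fun ω : Fin M → Ω =>
      ∃ i, M * δ < |∑ t, X i (ω t) - M * μ i|) ⊆ univ.biUnion fun i =>
        (univ.filter fun ω : Fin M → Ω => M * δ < ∑ t, (X i (ω t) - μ i)) ∪
        (univ.filter fun ω : Fin M → Ω => M * δ < ∑ t, -(X i (ω t) - μ i)) := by
    intro ω hω
    obtain ⟨i, hi⟩ := (mem_filter.1 hω).2
    have h1 : ∑ t, (X i (ω t) - μ i) = ∑ t, X i (ω t) - M * μ i := by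
      simp [sum_sub_distrib]
    rw [← h1] at hi
    simp only [mem_biUnion, mem_univ, true_and, mem_union, mem_filter, sum_neg_distrib]
    exact ⟨i, lt_abs.1 hi⟩
  calc _ ≤ (((univ : Finset ι).biUnion fun i =>
        (univ.filter fun ω : Fin M → Ω => M * δ < ∑ t, (X i (ω t) - μ i)) ∪
        (univ.filter fun ω : Fin M → Ω => M * δ < ∑ t, -(X i (ω t) - μ i))).card : ℝ) := by
        exact_mod_cast card_le_card hsub
    _ ≤ ∑ i : ι, (2 * Real.exp (-(M * δ ^ 2 / 4)) * (Fintype.card Ω : ℝ) ^ M) := by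
        refine le_trans (Nat.cast_le.2 card_biUnion_le) ?_
        push_cast
        refine sum_le_sum fun i _ => ?_
        refine le_trans (Nat.cast_le.2 (card_union_le _ _)) ?_
        push_cast
        have h1 := card_deviation_le (ha i) (hs i) hδ0 hδ1 M
        have h2 := card_deviation_le (Y := fun x => -(X i x - μ i))
          (fun x => by rw [abs_neg]; exact ha i x) (by rw [sum_neg_distrib, hs, neg_zero])
          hδ0 hδ1 M
        linarith
    _ = _ := by
        rw [sum_const, card_univ, nsmul_eq_mul]
        ring

end Concentration

/-! ### Sampling with random bits -/

/-- The tradeoff factor of node `u` in sample `t`, as a number with `b` binary digits, read off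
the list of bits. -/
def sampleValue (bits : ℕ → ℕ) (n b t u : ℕ) : ℕ :=
  ∑ j ∈ range b, bits (j + b * (u + n * t)) * 2 ^ j

/-- The bit sequence `r`, continued by zeros. -/
def extendBits {m : ℕ} (r : Fin m → Bool) (i : ℕ) : ℕ :=
  if h : i < m then (r ⟨i, h⟩).toNat else 0

/-- Bit sequences correspond to families of samples, together with the unused bits. -/
def sampleEquiv (M n b c : ℕ) :
    (Fin (M * n * b + c) → Bool) ≃ (Fin M → Fin n → Fin (2 ^ b)) × (Fin c → Bool) :=
  (Fin.appendEquiv (M * n * b) c).symm.trans <| Equiv.prodCongr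
    ((Equiv.arrowCongr (finProdFinEquiv.symm.trans
        (Equiv.prodCongr finProdFinEquiv.symm (Equiv.refl (Fin b)))) finTwoEquiv.symm).trans <|
      (Equiv.curry _ _ _).trans <| (Equiv.curry _ _ _).trans <|
        Equiv.arrowCongr (Equiv.refl _) <| Equiv.arrowCongr (Equiv.refl _) finFunctionFinEquiv)
    (Equiv.refl _)

theorem sampleEquiv_apply (M n b c : ℕ) (r : Fin (M * n * b + c) → Bool) (t : Fin M) (u : Fin n) :
    (((sampleEquiv M n b c r).1 t u : Fin (2 ^ b)) : ℕ) =
      sampleValue (extendBits r) n b t u := by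
  rw [sampleValue, ← Fin.sum_univ_eq_sum_range
    (fun j => extendBits r (j + b * (u + n * t)) * 2 ^ j)]
  have h1 : ∀ j : Fin b, (j : ℕ) + b * (u + n * t) < M * n * b + c := by
    intro j
    have := (finProdFinEquiv (finProdFinEquiv (t, u), j)).2
    simp only [finProdFinEquiv_apply_val] at this
    omega
  simp only [extendBits, h1, dif_pos]
  simp only [sampleEquiv, Equiv.trans_apply, Equiv.prodCongr_apply, Prod.map_fst,
    Equiv.curry_apply, Equiv.arrowCongr_apply, Function.comp_apply, finFunctionFinEquiv_apply,
    Function.curry_apply]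
  refine sum_congr rfl fun j _ => ?_
  congr 1
  simp only [Equiv.refl_symm, Equiv.refl_apply, Equiv.symm_trans_apply, Equiv.prodCongr_symm,
    Equiv.prodCongr_apply, Equiv.symm_symm, Prod.map_apply, Equiv.coe_refl,
    id]
  have h2 : ∀ x : Bool, ((finTwoEquiv.symm x : Fin 2) : ℕ) = x.toNat := by decide
  rw [h2]
  congr 1

/-- The samples obtained from uniform random bits are independent and uniform. -/
theorem ncard_samples (M n b m : ℕ) (hm : M * n * b ≤ m)
    (Q : (Fin M → Fin n → Fin (2 ^ b)) → Prop) [DecidablePred Q] :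
    ((Set.ncard {r : Fin m → Bool | ∃ l : Fin M → Fin n → Fin (2 ^ b),
        (∀ t u, (l t u : ℕ) = sampleValue (extendBits r) n b t u) ∧ Q l} : ℕ) : ℝ) / 2 ^ m =
      (univ.filter Q).card / (Fintype.card (Fin n → Fin (2 ^ b)) : ℝ) ^ M := by
  classical
  obtain ⟨c, rfl⟩ := Nat.exists_eq_add_of_le hm
  have h1 : {r : Fin (M * n * b + c) → Bool | ∃ l : Fin M → Fin n → Fin (2 ^ b),
      (∀ t u, (l t u : ℕ) = sampleValue (extendBits r) n b t u) ∧ Q l} =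
      (sampleEquiv M n b c).symm '' ((univ.filter Q ×ˢ univ :
        Finset ((Fin M → Fin n → Fin (2 ^ b)) × (Fin c → Bool))) : Set _) := by
    ext r
    rw [Equiv.image_symm_eq_preimage]
    simp only [Set.mem_ofPred_eq, coe_product, coe_filter, mem_univ, true_and, coe_univ,
      Set.mem_preimage, Set.mem_prod, Set.mem_univ, and_true]
    constructor
    · rintro ⟨l, hl, hQ⟩
      convert hQ
      ext t u
      rw [sampleEquiv_apply, hl]
    · exact fun h => ⟨_, fun t u => sampleEquiv_apply M n b c r t u, h⟩
  rw [h1, Set.ncard_image_of_injective _ (Equiv.injective _), Set.ncard_coe_finset, card_product]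
  simp only [card_univ, Fintype.card_pi, Fintype.card_bool, Fintype.card_fin, prod_const,
    Nat.cast_mul, Nat.cast_pow, Nat.cast_ofNat]
  rw [pow_add, mul_div_mul_right _ _ (by positivity), ← pow_mul, ← pow_mul]
  congr 2
  ring

/-! ### Bounding the running time of structured programs -/

section Machine

/-- All cells of the memory hold numbers with at most `K` bits. -/
def Bounded (K : ℕ) (s : Memory) : Prop := ∀ a i, s a i < 2 ^ K

/-- The memory `s` after writing `x` to cell `i` of array `a`. -/
def Memory.set (s : Memory) (a i x : ℕ) : Memory :=
  Function.update s a (Function.update (s a) i x)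

theorem Memory.set_same (s : Memory) (a i x : ℕ) : s.set a i x a i = x := by
  simp [Memory.set]

theorem Memory.set_of_ne (s : Memory) {a b : ℕ} (h : b ≠ a) (i x : ℕ) : s.set a i x b = s b := by
  simp [Memory.set, h]

theorem Memory.set_apply (s : Memory) (a i x j : ℕ) :
    s.set a i x a j = if j = i then x else s a j := by
  simp [Memory.set, Function.update_apply]

theorem Bounded.set {K : ℕ} {s : Memory} (h : Bounded K s) (a i : ℕ) {x : ℕ} (hx : x < 2 ^ K) :
    Bounded K (s.set a i x) := by
  intro b j
  rcases eq_or_ne b a with rfl | hb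
  · rw [Memory.set_apply]
    split_ifs
    · exact hx
    · exact h b j
  · rw [Memory.set_of_ne _ hb]
    exact h b j

/-- A bound for the number of bits of the value of an expression, as a polynomial in the number of
bits of the memory cells. -/
noncomputable def Expr.bits : Expr → Polynomial ℕ
  | .const x => .C x.size
  | .get _ _ => .X
  | .op _ e f => e.bits + f.bits + 1

theorem Expr.size_eval_le {K : ℕ} {s : Memory} (h : Bounded K s) (e : Expr) :
    (e.eval s).size ≤ e.bits.eval K := by
  induction e with
  | const x => simp [Expr.eval, Expr.bits]
  | get a i _ => simpa [Expr.eval, Expr.bits, Nat.size_le] using h a _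
  | op o e f ihe ihf =>
    simp only [Expr.eval, Expr.bits, Polynomial.eval_add, Polynomial.eval_one]
    rw [Nat.size_le] at *
    generalize e.eval s = x at *
    generalize f.eval s = y at *
    generalize e.bits.eval K = p at *
    generalize f.bits.eval K = q at *
    have hp : 2 ^ p ≤ 2 ^ (p + q + 1) := Nat.pow_le_pow_right two_pos (by omega)
    have hq : 2 ^ q ≤ 2 ^ (p + q) := Nat.pow_le_pow_right two_pos (by omega)
    have hp' : 2 ^ p ≤ 2 ^ (p + q) := Nat.pow_le_pow_right two_pos (by omega)
    have hpq : 2 ^ (p + q + 1) = 2 ^ (p + q) * 2 := pow_succ _ _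
    generalize 2 ^ (p + q + 1) = r at *
    cases o with
    | add => simp only [Op.eval]; omega
    | sub => simp only [Op.eval]; omega
    | mul =>
      have : x * y < 2 ^ p * 2 ^ q := Nat.mul_lt_mul'' ihe ihf
      rw [← pow_add] at this
      simp only [Op.eval]
      omega
    | div => exact (Nat.div_le_self x y).trans_lt (ihe.trans_le hp)
    | mod => exact (Nat.mod_le x y).trans_lt (ihe.trans_le hp)
    | lt =>
      have := Nat.one_le_two_pow (n := p + q)
      simp only [Op.eval]
      split_ifs <;> omega

/-- A bound for the time to evaluate an expression, as a polynomial in the number of bits of the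
memory cells. -/
noncomputable def Expr.cost : Expr → Polynomial ℕ
  | .const x => .C (x.size + 1)
  | .get _ i => i.cost + i.bits + .X + 1
  | .op _ e f => e.cost + f.cost + (e.bits + 1) * (f.bits + 1)

theorem Expr.time_le {K : ℕ} {s : Memory} (h : Bounded K s) (e : Expr) :
    e.time s ≤ e.cost.eval K := by
  induction e with
  | const x => simp [Expr.time, Expr.cost]
  | get a i ih =>
    have h1 := i.size_eval_le h
    have h2 : (s a (i.eval s)).size ≤ K := Nat.size_le.2 (h _ _)
    simp only [Expr.time, Expr.cost, Polynomial.eval_add, Polynomial.eval_X, Polynomial.eval_one]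
    omega
  | op o e f ihe ihf =>
    simp only [Expr.time, Expr.cost, Polynomial.eval_add, Polynomial.eval_mul,
      Polynomial.eval_one]
    have h1 := e.size_eval_le h
    have h2 := f.size_eval_le h
    gcongr

/-- A bound for the running time of a program, as a polynomial in a number `K` that bounds the
number of bits of all memory cells and the number of iterations of each loop. -/
noncomputable def Prog.cost : Prog → Polynomial ℕ
  | .skip => 1
  | .assign _ i e => i.cost + e.cost + i.bits + e.bits + 1
  | .seq P Q => P.cost + Q.cost
  | .ite e P Q => e.cost + 1 + P.cost + Q.cost
  | .while e P => .X * (e.cost + 1 + P.cost) + (e.cost + 1)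

/-- The arrays to which a program may write. -/
def Prog.writes : Prog → List ℕ
  | .skip => []
  | .assign a _ _ => [a]
  | .seq P Q => P.writes ++ Q.writes
  | .ite _ P Q => P.writes ++ Q.writes
  | .while _ P => P.writes

theorem Exec.eq_of_notMem_writes {P : Prog} {s s' : Memory} {t : ℕ} (h : Exec P s t s') {a : ℕ}
    (ha : a ∉ P.writes) : s' a = s a := by
  induction h with
  | skip s => rfl
  | assign b i e s =>
    simp only [Prog.writes, List.mem_singleton] at ha
    exact Memory.set_of_ne s ha _ _
  | seq _ _ ih ih' =>
    simp only [Prog.writes, List.mem_append, not_or] at ha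
    rw [ih' ha.2, ih ha.1]
  | ite_true _ _ ih =>
    simp only [Prog.writes, List.mem_append, not_or] at ha
    exact ih ha.1
  | ite_false _ _ ih =>
    simp only [Prog.writes, List.mem_append, not_or] at ha
    exact ih ha.2
  | while_true _ _ _ ih ih' => rw [ih' ha, ih ha]
  | while_false _ => rfl

/-- Total correctness: from the memory `s`, if it is bounded, the program halts within its time
bound in a bounded memory that satisfies `Q`. -/
def Runs (K : ℕ) (P : Prog) (s : Memory) (Q : Memory → Prop) : Prop :=
  Bounded K s → ∃ t s', Exec P s t s' ∧ t ≤ P.cost.eval K ∧ Bounded K s' ∧ Q s'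

variable {K : ℕ} {s : Memory} {Q : Memory → Prop}

theorem Runs.mono {P : Prog} {Q' : Memory → Prop} (h : Runs K P s Q)
    (hQ : ∀ s', (∀ a, a ∉ P.writes → s' a = s a) → Q s' → Q' s') : Runs K P s Q' := by
  intro hs
  obtain ⟨t, s', he, ht, hb, hq⟩ := h hs
  exact ⟨t, s', he, ht, hb, hQ s' (fun a ha => he.eq_of_notMem_writes ha) hq⟩

theorem Runs.skip (h : Q s) : Runs K .skip s Q :=
  fun hs => ⟨1, s, .skip s, by simp [Prog.cost], hs, h⟩

theorem Runs.assign {a : ℕ} {i e : Expr} (he : e.eval s < 2 ^ K)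
    (h : Q (s.set a (i.eval s) (e.eval s))) : Runs K (.assign a i e) s Q := by
  intro hs
  refine ⟨_, _, .assign a i e s, ?_, hs.set _ _ he, h⟩
  simp only [Prog.cost, Polynomial.eval_add, Polynomial.eval_one]
  gcongr
  · exact i.time_le hs
  · exact e.time_le hs
  · exact i.size_eval_le hs
  · exact e.size_eval_le hs

theorem Runs.seq {P P' : Prog} {R : Memory → Prop} (h : Runs K P s R)
    (h' : ∀ s', (∀ a, a ∉ P.writes → s' a = s a) → R s' → Runs K P' s' Q) :
    Runs K (.seq P P') s Q := by
  intro hs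
  obtain ⟨t, s', he, ht, hb, hr⟩ := h hs
  obtain ⟨t', s'', he', ht', hb', hq⟩ := h' s' (fun a ha => he.eq_of_notMem_writes ha) hr hb
  refine ⟨t + t', s'', .seq he he', ?_, hb', hq⟩
  simp only [Prog.cost, Polynomial.eval_add]
  omega

theorem Runs.ite {e : Expr} {P P' : Prog} (h : e.eval s ≠ 0 → Runs K P s Q)
    (h' : e.eval s = 0 → Runs K P' s Q) : Runs K (.ite e P P') s Q := by
  intro hs
  have h1 := e.time_le hs
  by_cases hc : e.eval s = 0
  · obtain ⟨t, s', he, ht, hb, hq⟩ := h' hc hs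
    refine ⟨_, s', .ite_false hc he, ?_, hb, hq⟩
    simp only [Prog.cost, Polynomial.eval_add, Polynomial.eval_one]
    omega
  · obtain ⟨t, s', he, ht, hb, hq⟩ := h hc hs
    refine ⟨_, s', .ite_true hc he, ?_, hb, hq⟩
    simp only [Prog.cost, Polynomial.eval_add, Polynomial.eval_one]
    omega

/-! ### Expressions and loops -/

instance : Add Expr := ⟨.op .add⟩

instance : Sub Expr := ⟨.op .sub⟩

instance : Mul Expr := ⟨.op .mul⟩

instance : Div Expr := ⟨.op .div⟩

/-- The comparison of the values of two expressions. -/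
def Expr.less (e f : Expr) : Expr := .op .lt e f

/-- The content of cell `0` of array `a`, which serves as a simple variable. -/
def Expr.var (a : ℕ) : Expr := .get a (.const 0)

@[simp] theorem Expr.eval_add (e f : Expr) (s : Memory) :
    (e + f).eval s = e.eval s + f.eval s := rfl

@[simp] theorem Expr.eval_sub (e f : Expr) (s : Memory) :
    (e - f).eval s = e.eval s - f.eval s := rfl

@[simp] theorem Expr.eval_mul (e f : Expr) (s : Memory) :
    (e * f).eval s = e.eval s * f.eval s := rfl

@[simp] theorem Expr.eval_div (e f : Expr) (s : Memory) :
    (e / f).eval s = e.eval s / f.eval s := rfl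

@[simp] theorem Expr.eval_less (e f : Expr) (s : Memory) :
    (e.less f).eval s = if e.eval s < f.eval s then 1 else 0 := rfl

@[simp] theorem Expr.eval_const (x : ℕ) (s : Memory) : (Expr.const x).eval s = x := rfl

@[simp] theorem Expr.eval_get (a : ℕ) (i : Expr) (s : Memory) :
    (Expr.get a i).eval s = s a (i.eval s) := rfl

@[simp] theorem Expr.eval_var (a : ℕ) (s : Memory) : (Expr.var a).eval s = s a 0 := rfl

/-- The counter of the loop, in array `a`, runs through the numbers below the value of `e`, in
descending order. -/
def Prog.forLoop (a : ℕ) (e : Expr) (P : Prog) : Prog :=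
  .seq (.assign a (.const 0) e)
    (.while (.var a) (.seq (.assign a (.const 0) (.var a - .const 1)) P))

/-- The rule for loops: `I j` is the invariant once the numbers from `j` on have been treated. -/
theorem Runs.forLoop {a : ℕ} {e : Expr} {P : Prog} {I : ℕ → Memory → Prop} {N : ℕ}
    (hN : e.eval s = N) (hNK : N ≤ K) (ha : a ∉ P.writes) (h0 : I N (s.set a 0 N))
    (h : ∀ j < N, ∀ s', (∀ b, b ≠ a → b ∉ P.writes → s' b = s b) → I (j + 1) s' →
      Runs K P (s'.set a 0 j) (I j)) :
    Runs K (.forLoop a e P) s (I 0) := by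
  have hK : N < 2 ^ K := hNK.trans_lt Nat.lt_two_pow_self
  refine Runs.seq (R := fun s' => s' a 0 = N ∧ I N s' ∧ ∀ b, b ≠ a → s' b = s b)
    (.assign (by omega) ?_) ?_
  · rw [hN]
    exact ⟨Memory.set_same _ _ _ _, h0, fun b hb => Memory.set_of_ne _ hb _ _⟩
  set c : ℕ := (Expr.var a).cost.eval K + 1 +
    (Prog.seq (.assign a (.const 0) (.var a - .const 1)) P).cost.eval K with hc
  rintro s₁ - ⟨hs₁, hI₁, hf₁⟩
  have key : ∀ j ≤ N, ∀ s', s' a 0 = j → I j s' →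
      (∀ b, b ≠ a → b ∉ P.writes → s' b = s b) → Bounded K s' →
      ∃ t s'', Exec (.while (.var a) (.seq (.assign a (.const 0) (.var a - .const 1)) P)) s' t s'' ∧
        t ≤ j * c + ((Expr.var a).cost.eval K + 1) ∧ Bounded K s'' ∧ I 0 s'' := by
    intro j
    induction j with
    | zero =>
      intro _ s' hj hI _ hb
      refine ⟨_, s', .while_false (by simpa using hj), ?_, hb, hI⟩
      have := (Expr.var a).time_le hb
      omega
    | succ j ih =>
      intro hjN s' hj hI hf hb
      have hbody : Runs K (.seq (.assign a (.const 0) (.var a - .const 1)) P) s'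
          (fun s'' => s'' a 0 = j ∧ I j s'' ∧ ∀ b, b ≠ a → b ∉ P.writes → s'' b = s b) := by
        refine Runs.seq (R := fun s'' => s'' = s'.set a 0 j) (.assign ?_ ?_) ?_
        · simp only [Expr.eval_sub, Expr.eval_var, Expr.eval_const, hj]
          omega
        · simp [hj]
        · rintro _ - rfl
          refine (h j (by omega) s' hf hI).mono fun s'' hfr hI' => ⟨?_, hI', fun b hb hbP => ?_⟩
          · rw [hfr a ha, Memory.set_same]
          · rw [hfr b hbP, Memory.set_of_ne _ hb, hf b hb hbP]
      obtain ⟨t, s'', he, ht, hb', hj', hI', hf'⟩ := hbody hb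
      obtain ⟨t', s₃, he', ht', hb₃, hI₃⟩ := ih (by omega) s'' hj' hI' hf' hb'
      refine ⟨_, s₃, .while_true (by simp [hj]) he he', ?_, hb₃, hI₃⟩
      have := (Expr.var a).time_le hb
      rw [add_mul, one_mul]
      omega
  intro hb
  obtain ⟨t, s', he, ht, hb', hI⟩ := key N le_rfl s₁ hs₁ hI₁ (fun b hb _ => hf₁ b hb) hb
  refine ⟨t, s', he, ht.trans ?_, hb', hI⟩
  simp only [Prog.cost, Polynomial.eval_add, Polynomial.eval_mul, Polynomial.eval_X,
    Polynomial.eval_one] at hc ⊢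
  rw [← hc]
  gcongr

/-- A loop that computes a value step by step in the variable `acc`, starting from `e₀` and
replacing it by `e₁` after each run of `P`. -/
def Prog.accumulate (acc a : ℕ) (e₀ e : Expr) (P : Prog) (e₁ : Expr) : Prog :=
  .seq (.assign acc (.const 0) e₀) (.forLoop a e (.seq P (.assign acc (.const 0) e₁)))

/-- The rule for accumulating loops: `G j` is the value once the numbers from `j` on have been
treated. -/
theorem Runs.accumulate {acc a : ℕ} {e₀ e e₁ : Expr} {P : Prog} (G : ℕ → ℕ) {N : ℕ}
    (hN : e.eval (s.set acc 0 (e₀.eval s)) = N) (hNK : N ≤ K) (haP : a ∉ P.writes)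
    (hacc : acc ≠ a) (hG : ∀ j ≤ N, G j < 2 ^ K) (h0 : e₀.eval s = G N)
    (h : ∀ j < N, ∀ s', (∀ b, b ≠ a → b ≠ acc → b ∉ P.writes → s' b = s b) → s' a 0 = j →
      s' acc 0 = G (j + 1) → Runs K P s' (fun s'' => e₁.eval s'' = G j)) :
    Runs K (.accumulate acc a e₀ e P e₁) s (fun s' => s' acc 0 = G 0) := by
  refine Runs.seq (R := fun s' => s' = s.set acc 0 (e₀.eval s)) (.assign ?_ rfl) ?_
  · rw [h0]
    exact hG N le_rfl
  rintro _ - rfl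
  refine Runs.forLoop (I := fun j s' => s' acc 0 = G j) hN hNK ?_ ?_ ?_
  · simp only [Prog.writes, List.mem_append, List.mem_singleton, not_or]
    exact ⟨haP, hacc.symm⟩
  · rw [Memory.set_of_ne _ hacc, Memory.set_same, h0]
  · intro j hj s' hf hI
    refine Runs.seq (R := fun s'' => e₁.eval s'' = G j) (h j hj _ (fun b hb hb' hbP => ?_) ?_ ?_) ?_
    · rw [Memory.set_of_ne _ hb, hf b hb, Memory.set_of_ne _ hb']
      simp only [Prog.writes, List.mem_append, List.mem_singleton, not_or]
      exact ⟨hbP, hb'⟩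
    · rw [Memory.set_same]
    · rw [Memory.set_of_ne _ hacc, hI]
    · intro s'' _ hs''
      refine .assign ?_ ?_
      · rw [hs'']
        exact hG j hj.le
      · rw [hs'']
        exact Memory.set_same _ _ _ _

end Machine

/-! ### The process in integer arithmetic -/

section UniformLaw

variable {V : Type*} [Fintype V] [DecidableEq V] {Ω : Type*} [Fintype Ω]

open Classical in
/-- The law of the response `ρ x` for a uniform random element `x` of a finite set. -/
noncomputable def uniformLaw (ρ : Ω → Response V) (R : Response V) : ℝ :=
  (univ.filter fun x => ρ x = R).card / Fintype.card Ω

open Classical in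
theorem marginal_uniformLaw (ρ : Ω → Response V) (A : Finset V) :
    marginal (uniformLaw ρ) A = (univ.filter fun x => ρ x A).card / Fintype.card Ω := by
  have h := card_eq_sum_card_fiberwise (f := ρ) (s := univ.filter fun x => ρ x A)
    (t := univ.filter fun R => R A) (by intro x; simp)
  simp only [marginal, uniformLaw, mul_ite, mul_one, mul_zero]
  rw [← sum_filter, ← sum_div, h, Nat.cast_sum]
  congr 1
  refine sum_congr rfl fun R hR => ?_
  congr 2
  ext x
  simp only [mem_filter, mem_univ, true_and] at hR ⊢
  exact ⟨fun h => ⟨h ▸ hR, h⟩, fun h => h.2⟩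

theorem isLaw_uniformLaw [Nonempty Ω] (ρ : Ω → Response V) : IsLaw (uniformLaw ρ) where
  nonneg R := by
    unfold uniformLaw
    positivity
  sum_eq_one := by
    classical
    have h := card_eq_sum_card_fiberwise (f := ρ) (s := univ) (t := univ) (by intro x; simp)
    have hc : (Fintype.card Ω : ℝ) ≠ 0 := by exact_mod_cast Fintype.card_ne_zero
    simp only [uniformLaw]
    rw [← sum_div, div_eq_one_iff_eq hc, ← card_univ, h, Nat.cast_sum]

theorem expect_uniformLaw (ρ : V → Ω → Response V) (F : (V → Response V) → ℝ) :
    expect (fun v => uniformLaw (ρ v)) F =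
      (∑ ω : V → Ω, F fun v => ρ v (ω v)) / Fintype.card (V → Ω) := by
  classical
  have h1 : ∀ v R, uniformLaw (ρ v) R =
      ∑ x, if ρ v x = R then (Fintype.card Ω : ℝ)⁻¹ else 0 := by
    intro v R
    rw [uniformLaw, ← sum_filter, sum_const, nsmul_eq_mul, div_eq_mul_inv]
  simp only [expect, h1]
  simp only [prod_univ_sum, Fintype.piFinset_univ, sum_mul]
  rw [sum_comm, sum_div]
  refine sum_congr rfl fun ω _ => ?_
  rw [sum_eq_single fun v => ρ v (ω v)]
  · simp [div_eq_inv_mul]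
  · intro R _ hR
    obtain ⟨v, hv⟩ := Function.ne_iff.1 hR
    rw [prod_eq_zero (mem_univ v), zero_mul]
    rw [if_neg (Ne.symm hv)]
  · simp

end UniformLaw

namespace Network

variable {V : Type*} [Fintype V]

/-- A common denominator of the demands. -/
def demandDen (N : Network V) : ℕ := ∏ v, (N.demand v).den

/-- The demands, scaled to integers. -/
def intDemand (N : Network V) (v : V) : ℕ :=
  (N.demand v).num * (N.demandDen / (N.demand v).den)

/-- A common denominator of the connection qualities. -/
def qualityDen (N : Network V) : ℕ := ∏ v, ∏ w, (N.quality v w).den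

/-- The connection qualities, scaled to integers. -/
def intQuality (N : Network V) (v w : V) : ℕ :=
  (N.quality v w).num * (N.qualityDen / (N.quality v w).den)

theorem num_mul_div_den_eq {q : ℚ≥0} {d : ℕ} (h : q.den ∣ d) :
    ((q.num * (d / q.den) : ℕ) : ℝ) = d * (q : ℝ) := by
  have h0 : (q.den : ℝ) ≠ 0 := by exact_mod_cast q.den_ne_zero
  rw [Nat.cast_mul, Nat.cast_div h h0, NNRat.cast_def]
  field_simp

theorem cast_intDemand (N : Network V) (v : V) :
    (N.intDemand v : ℝ) = N.demandDen * (N.demand v : ℝ) :=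
  num_mul_div_den_eq (dvd_prod_of_mem _ (mem_univ v))

theorem cast_intQuality (N : Network V) (v w : V) :
    (N.intQuality v w : ℝ) = N.qualityDen * (N.quality v w : ℝ) :=
  num_mul_div_den_eq ((dvd_prod_of_mem (fun w => (N.quality v w).den) (mem_univ w)).trans
    (dvd_prod_of_mem (fun v => ∏ w, (N.quality v w).den) (mem_univ v)))

theorem demandDen_pos (N : Network V) : 0 < N.demandDen :=
  prod_pos fun v _ => (N.demand v).den_pos

theorem qualityDen_pos (N : Network V) : 0 < N.qualityDen :=
  prod_pos fun v _ => prod_pos fun w _ => (N.quality v w).den_pos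

/-- An integer approximation to the demand seen by `u`, in units of `1 / Z` of the scaled
demands, when `u` shares together with the nodes of `A`. The node `u` is always counted on top of
`A`, so that the value is meaningful for `u ∉ A` only. -/
def intLoad (N : Network V) (Z : ℕ) (A : Finset V) (u : V) : ℕ :=
  ∑ v, Z * N.intDemand v * N.intQuality v u /
    (N.intQuality v u + ∑ w ∈ A, N.intQuality v w)

theorem intLoad_anti (N : Network V) (Z : ℕ) {A B : Finset V} (h : A ⊆ B) (u : V) :
    N.intLoad Z B u ≤ N.intLoad Z A u := by
  refine sum_le_sum fun v _ => ?_
  rcases Nat.eq_zero_or_pos (N.intQuality v u) with h0 | h0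
  · simp [h0]
  · exact Nat.div_le_div_left (Nat.add_le_add_left (sum_le_sum_of_subset h) _) (by omega)

/-- The response of `u`, in integer arithmetic, when its tradeoff factor is `x / Z`. -/
def intResponse (N : Network V) (Z : ℕ) (u : V) (x : ℕ) : Response V where
  toFun A := (N.cost u).num ≠ 0 ∧ N.intLoad Z A u < x * ∑ v, N.intDemand v
  monotone' _ _ h hA := ⟨hA.1, (N.intLoad_anti Z h u).trans_lt hA.2⟩

theorem intResponse_iff (N : Network V) (Z : ℕ) (u : V) (x : ℕ) (A : Finset V) :
    N.intResponse Z u x A ↔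
      (N.cost u).num ≠ 0 ∧ N.intLoad Z A u < x * ∑ v, N.intDemand v := Iff.rfl

variable [DecidableEq V]

theorem intLoad_bounds (N : Network V) (Z : ℕ) {A : Finset V} {u : V} (hu : u ∉ A) :
    (N.intLoad Z A u : ℝ) ≤ Z * (N.demandDen * N.load (insert u A) u) ∧
      Z * (N.demandDen * N.load (insert u A) u) ≤ N.intLoad Z A u + Fintype.card V := by
  have hQ : (0 : ℝ) < N.qualityDen := by exact_mod_cast N.qualityDen_pos
  have h1 : ∀ v, (Z : ℝ) * (N.demandDen * ((N.demand v : ℝ) * (N.quality v u : ℝ) /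
      ∑ w ∈ insert u A, (N.quality v w : ℝ))) =
      ((Z * N.intDemand v * N.intQuality v u : ℕ) : ℝ) /
        ((N.intQuality v u + ∑ w ∈ A, N.intQuality v w : ℕ) : ℝ) := by
    intro v
    push_cast
    simp only [cast_intDemand, cast_intQuality]
    rw [← mul_sum, ← mul_add, sum_insert hu, ← mul_div_assoc, ← mul_div_assoc,
      ← mul_div_mul_left _ _ hQ.ne']
    congr 1
    ring
  rw [load, mul_sum, mul_sum, intLoad, Nat.cast_sum]
  simp only [h1]
  constructor
  · exact sum_le_sum fun v _ => Nat.cast_div_le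
  · rw [← card_univ, ← nsmul_one, ← sum_const, ← sum_add_distrib]
    refine sum_le_sum fun v _ => ?_
    rw [← Nat.floor_div_eq_div (K := ℝ)]
    exact (Nat.lt_floor_add_one _).le

theorem card_filter_lt_mul {Z F D : ℕ} (hD : 0 < D) :
    (univ.filter fun x : Fin Z => F < x * D).card = Z - (F / D + 1) := by
  have h : (univ.filter fun x : Fin Z => F < x * D).card =
      ((range Z).filter fun x => F < x * D).card := by
    rw [card_filter, card_filter, Fin.sum_univ_eq_sum_range fun x => if F < x * D then 1 else 0]
  rw [h]
  have : (range Z).filter (fun x => F < x * D) = Ico (F / D + 1) Z := by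
    ext x
    simp only [mem_filter, mem_range, mem_Ico, Nat.succ_le_iff, Nat.div_lt_iff_lt_mul hD]
    tauto
  rw [this, Nat.card_Ico]

/-- The discretization changes the probability of each response only by `O(n / Z)`. -/
theorem abs_marginal_law_sub_le (N : Network V) {Z : ℕ} (hZ : 0 < Z) {u : V} {A : Finset V}
    (hu : u ∉ A) :
    |marginal (N.law u) A -
      marginal (uniformLaw fun x : Fin Z => N.intResponse Z u x) A| ≤
        ((Fintype.card V : ℝ) + 1) / Z := by
  have hZ' : (0 : ℝ) < Z := by exact_mod_cast hZ
  have hDD : (0 : ℝ) < N.demandDen := by exact_mod_cast N.demandDen_pos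
  have hDc : ((∑ v, N.intDemand v : ℕ) : ℝ) = N.demandDen * N.total := by
    simp only [Nat.cast_sum, cast_intDemand, total, mul_sum]
  have hpos : 0 ≤ ((Fintype.card V : ℝ) + 1) / Z := by positivity
  rw [marginal_law, marginal_uniformLaw]
  simp only [intResponse_iff, Fintype.card_fin]
  by_cases hc : N.cost u = 0
  · simpa [hc] using hpos
  by_cases hD : N.total = 0
  · have hD0 : ∑ v, N.intDemand v = 0 := by
      rw [hD, mul_zero] at hDc
      exact_mod_cast hDc
    simpa [hD, hD0] using hpos
  have hDpos : 0 < N.total := lt_of_le_of_ne N.total_nonneg (Ne.symm hD)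
  have hDn : 0 < ∑ v, N.intDemand v := by
    have : (0 : ℝ) < ((∑ v, N.intDemand v : ℕ) : ℝ) := by
      rw [hDc]
      positivity
    exact_mod_cast this
  have hc' : (N.cost u).num ≠ 0 := by simpa using hc
  simp only [hc, hD, or_self, if_false, hc', ne_eq, not_false_eq_true, true_and]
  obtain ⟨h1, h2⟩ := N.intLoad_bounds Z hu
  have hle : N.load (insert u A) u ≤ N.total := N.load_le_total (mem_insert_self u A)
  set φ := N.load (insert u A) u / N.total with hφ
  have hload : N.demandDen * N.load (insert u A) u = φ * ((∑ v, N.intDemand v : ℕ) : ℝ) := by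
    rw [hDc, hφ]
    field_simp
  have hφ1 : φ ≤ 1 := (div_le_one hDpos).2 hle
  rw [hload] at h1 h2
  set D := ∑ v, N.intDemand v
  set F := N.intLoad Z A u
  have hD1 : (1 : ℝ) ≤ D := by exact_mod_cast hDn
  have hcard := card_filter_lt_mul (Z := Z) (F := F) hDn
  have hx : |((univ.filter fun x : Fin Z => F < x * D).card : ℝ) - Z * (1 - φ)| ≤
      Fintype.card V + 1 := by
    have h3 : ((F / D : ℕ) : ℝ) * D ≤ F := by exact_mod_cast Nat.div_mul_le_self F D
    have h4 : (F : ℝ) < ((F / D : ℕ) + 1) * D := by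
      exact_mod_cast Nat.lt_mul_of_div_lt (Nat.lt_succ_self (F / D)) hDn
    have h5 : ((F / D : ℕ) : ℝ) ≤ Z * φ := by
      refine le_of_mul_le_mul_right ?_ (show (0 : ℝ) < D by linarith)
      linarith
    have h6 : Z * φ ≤ (F / D : ℕ) + 1 + Fintype.card V := by
      refine le_of_mul_le_mul_right ?_ (show (0 : ℝ) < D by linarith)
      have : (Fintype.card V : ℝ) ≤ Fintype.card V * D :=
        le_mul_of_one_le_right (by positivity) hD1
      linarith
    have h7 : (Z : ℝ) * φ ≤ Z := mul_le_of_le_one_right hZ'.le hφ1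
    rw [hcard]
    rcases le_total (F / D + 1) Z with h8 | h8
    · rw [Nat.cast_sub h8, abs_le]
      push_cast
      constructor <;> linarith
    · rw [Nat.sub_eq_zero_of_le h8, abs_le]
      have : (Z : ℝ) ≤ (F / D : ℕ) + 1 := by exact_mod_cast h8
      push_cast
      have : (0 : ℝ) ≤ Fintype.card V := by positivity
      constructor <;> linarith
  have hx' : 1 - φ - ((univ.filter fun x : Fin Z => F < x * D).card : ℝ) / Z =
      -((((univ.filter fun x : Fin Z => F < x * D).card : ℝ) - Z * (1 - φ)) / Z) := by
    field_simp
    ring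
  rw [hx', abs_neg, abs_div, abs_of_pos hZ']
  gcongr

/-- The number of sharing nodes at the end of the process in integer arithmetic. -/
noncomputable def intSpread (N : Network V) (Z : ℕ) (x : V → ℕ) (S : Finset V) : Finset V :=
  spread (fun u => N.intResponse Z u (x u)) S

theorem abs_average_sub_expectedSpread_le (N : Network V) {Z : ℕ} (hZ : 0 < Z) (S : Finset V) :
    |(∑ x : V → Fin Z, ((N.intSpread Z (fun u => x u) S).card : ℝ)) /
      Fintype.card (V → Fin Z) - N.expectedSpread S| ≤
      Fintype.card V * (Fintype.card V * (((Fintype.card V : ℝ) + 1) / Z)) := by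
  have : Nonempty (Fin Z) := ⟨⟨0, hZ⟩⟩
  have h := abs_expectedSize_sub_le N.isLaw_law
    (fun u => isLaw_uniformLaw fun x : Fin Z => N.intResponse Z u x)
    (fun u A hu => N.abs_marginal_law_sub_le hZ hu) S
  rw [abs_sub_comm, ← expectedSpread_eq, expectedSize, expect_uniformLaw] at h
  exact h

end Network

/-! ### Loops that compute sums and products -/

section Loops

variable {K : ℕ} {s : Memory}

theorem filter_le_eq_insert {N j : ℕ} (hj : j < N) :
    (univ.filter fun i : Fin N => j ≤ (i : ℕ)) =
      insert ⟨j, hj⟩ (univ.filter fun i : Fin N => j + 1 ≤ (i : ℕ)) := by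
  ext i
  simp only [mem_filter, mem_univ, true_and, mem_insert, Fin.ext_iff]
  omega

theorem notMem_filter_succ_le {N j : ℕ} (hj : j < N) :
    (⟨j, hj⟩ : Fin N) ∉ univ.filter fun i : Fin N => j + 1 ≤ (i : ℕ) := by
  simp

theorem filter_le_self (N : ℕ) : (univ.filter fun i : Fin N => N ≤ (i : ℕ)) = ∅ := by
  ext i
  simp

theorem Runs.sum {acc a c N : ℕ} {e₀ e t : Expr} {P : Prog} (f : Fin N → ℕ)
    (hN : e.eval (s.set acc 0 (e₀.eval s)) = N) (hNK : N ≤ K) (haP : a ∉ P.writes)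
    (hacc : acc ≠ a) (haccP : acc ∉ P.writes) (hG : c + ∑ i, f i < 2 ^ K) (h0 : e₀.eval s = c)
    (h : ∀ j : Fin N, ∀ s' : Memory, (∀ b, b ≠ a → b ≠ acc → b ∉ P.writes → s' b = s b) →
      s' a 0 = j → Runs K P s' (fun s'' => t.eval s'' = f j)) :
    Runs K (.accumulate acc a e₀ e P (.var acc + t)) s (fun s' => s' acc 0 = c + ∑ i, f i) := by
  refine (Runs.accumulate (fun j => c + ∑ i ∈ univ.filter (fun i : Fin N => j ≤ (i : ℕ)), f i)
    hN hNK haP hacc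
    ?_ ?_ ?_).mono ?_
  · intro j _
    refine lt_of_le_of_lt ?_ hG
    exact Nat.add_le_add_left (sum_le_sum_of_subset (subset_univ _)) _
  · simp [h0, filter_le_self]
  · intro j hj s' hf ha hs
    refine (h ⟨j, hj⟩ s' hf ha).mono fun s'' hf' ht => ?_
    rw [Expr.eval_add, Expr.eval_var, ht, hf' _ haccP, hs, filter_le_eq_insert hj,
      sum_insert (notMem_filter_succ_le hj)]
    ring
  · intro s' _ hs
    simpa using hs

theorem Runs.prod {acc a N : ℕ} {e t : Expr} (f : Fin N → ℕ) (hf : ∀ i, 0 < f i)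
    (hN : e.eval (s.set acc 0 1) = N) (hNK : N ≤ K) (hacc : acc ≠ a) (hG : ∏ i, f i < 2 ^ K)
    (h : ∀ j : Fin N, ∀ s' : Memory, (∀ b, b ≠ a → b ≠ acc → s' b = s b) → s' a 0 = j →
      t.eval s' = f j) :
    Runs K (.accumulate acc a (.const 1) e .skip (.var acc * t)) s
      (fun s' => s' acc 0 = ∏ i, f i) := by
  refine (Runs.accumulate (fun j => ∏ i ∈ univ.filter (fun i : Fin N => j ≤ (i : ℕ)), f i)
    hN hNK (by simp [Prog.writes]) hacc ?_ ?_ ?_).mono ?_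
  · intro j _
    refine lt_of_le_of_lt ?_ hG
    exact prod_le_prod_of_subset_of_one_le' (filter_subset _ _) fun i _ _ => hf i
  · simp [filter_le_self]
  · intro j hj s' hfr ha hs
    refine .skip ?_
    have ht := h ⟨j, hj⟩ s' (fun b hb hb' => hfr b hb hb' (by simp [Prog.writes])) ha
    rw [Expr.eval_mul, Expr.eval_var, hs, ht,
      filter_le_eq_insert hj, prod_insert (notMem_filter_succ_le hj), mul_comm]
  · intro s' _ hs
    simpa using hs

theorem sum_bits_lt {g : ℕ → ℕ} (hg : ∀ i, g i ≤ 1) (m : ℕ) :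
    ∑ l ∈ range m, g l * 2 ^ l < 2 ^ m := by
  induction m with
  | zero => simp
  | succ m ih =>
    rw [sum_range_succ, pow_succ]
    have := Nat.mul_le_mul_right (2 ^ m) (hg m)
    omega

end Loops

/-! ### The program -/

namespace Greedy

/-- The number of nodes. -/
def size : Expr := .var 2

/-- The number of seeds to be selected. -/
def seeds : Expr := .get 2 (.const 1)

/-- The number of random bits for each tradeoff factor. -/
def digits (κ : ℕ) : Expr := .const 3 * size + .const κ

/-- The number of samples. -/
def samples (μ : ℕ) : Expr := .const μ * (size * size * size)

/-- The scaled demand of node `v`, once the common denominator is in variable `9`. -/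
def demand (v : Expr) : Expr := .get 5 v * (.var 9 / .get 6 v)

/-- A scaled connection quality, once the common denominator is in variable `10`. -/
def quality (v w : Expr) : Expr :=
  .get 7 (v * size + w) * (.var 10 / .get 8 (v * size + w))

/-- Computes the common denominators in the variables `9` and `10`, the denominator of the tradeoff
factors in variable `11`, and the total scaled demand in variable `12`. -/
def setup (κ : ℕ) : Prog :=
  .seq (.accumulate 9 20 (.const 1) size .skip (.var 9 * .get 6 (.var 20))) <|
  .seq (.accumulate 10 20 (.const 1) (size * size) .skip (.var 10 * .get 8 (.var 20))) <|
  .seq (.accumulate 11 20 (.const 1) (digits κ) .skip (.var 11 * .const 2))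
    (.accumulate 12 20 (.const 0) size .skip (.var 12 + demand (.var 20)))

/-- Computes in variable `14` the load of node `26` on top of the set in array `13`. -/
def load : Prog :=
  .accumulate 14 27 (.const 0) size
    (.accumulate 15 28 (quality (.var 27) (.var 26)) size .skip
      (.var 15 + .get 13 (.var 28) * quality (.var 27) (.var 28)))
    (.var 14 + .var 11 * demand (.var 27) * quality (.var 27) (.var 26) / .var 15)

/-- Reads in variable `16` the tradeoff factor of node `26` in sample `23`. -/
def sample (κ : ℕ) : Prog :=
  .accumulate 16 29 (.const 0) (digits κ) .skip
    (.var 16 * .const 2 + .get 0 (.var 29 + digits κ * (.var 26 + size * .var 23)))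

/-- Adds node `26` to the set in array `13` if it responds to that set. -/
def update (κ : ℕ) : Prog :=
  .seq load <| .seq (sample κ) <|
    .ite (.get 3 (.var 26) * (Expr.var 14).less (.var 16 * .var 12))
      (.assign 13 (.var 26) (.const 1)) .skip

/-- Computes in array `13` the spread in sample `23` when the seeds are those in array `1` together
with node `22`. -/
def cascade (κ : ℕ) : Prog :=
  .seq (.forLoop 24 size (.assign 13 (.var 24) (.get 1 (.var 24)))) <|
  .seq (.assign 13 (.var 22) (.const 1)) <|
    .forLoop 25 size (.forLoop 26 size (update κ))

/-- Computes in variable `17` the sum of the sizes of the spreads over all samples, plus `1`, when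
the seeds are those in array `1` together with node `22`. -/
def evaluate (κ μ : ℕ) : Prog :=
  .accumulate 17 23 (.const 1) (samples μ)
    (.seq (cascade κ) (.accumulate 31 30 (.const 0) size .skip (.var 31 + .get 13 (.var 30))))
    (.var 17 + .var 31)

/-- Keeps in the variables `18` and `19` the best value and the best new node met so far. -/
def candidate (κ μ : ℕ) : Prog :=
  .ite (.get 1 (.var 22)) .skip <|
    .seq (evaluate κ μ) <|
      .ite ((Expr.var 18).less (.var 17))
        (.seq (.assign 18 (.const 0) (.var 17)) (.assign 19 (.const 0) (.var 22))) .skip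

/-- The greedy algorithm on the empirical average of the spread. The arrays `0` to `8` are those of
the initial memory, array `13` holds a set of sharing nodes, and all other arrays are used as
variables; those with the numbers `20` to `30` are loop counters. -/
def program (κ μ : ℕ) : Prog :=
  .seq (setup κ) <|
    .forLoop 21 seeds <|
      .seq (.assign 18 (.const 0) (.const 0)) <|
      .seq (.forLoop 22 size (candidate κ μ)) (.assign 1 (.var 19) (.const 1))

theorem writes_load : load.writes = [14, 27, 27, 15, 28, 28, 15, 14] := rfl

theorem writes_sample (κ : ℕ) : (sample κ).writes = [16, 29, 29, 16] := rfl

theorem writes_update (κ : ℕ) :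
    (update κ).writes = [14, 27, 27, 15, 28, 28, 15, 14, 16, 29, 29, 16, 13] := rfl

theorem writes_cascade (κ : ℕ) : (cascade κ).writes =
    [24, 24, 13, 13, 25, 25, 26, 26, 14, 27, 27, 15, 28, 28, 15, 14, 16, 29, 29, 16, 13] := rfl

theorem writes_evaluate (κ μ : ℕ) : (evaluate κ μ).writes =
    [17, 23, 23] ++ (cascade κ).writes ++ [31, 30, 30, 31, 17] := rfl

theorem writes_candidate (κ μ : ℕ) : (candidate κ μ).writes =
    (evaluate κ μ).writes ++ [18, 19] := by
  simp [candidate, Prog.writes]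

variable {n : ℕ} {N : Network (Fin n)} {k κ M L K : ℕ} {bits : ℕ → ℕ} {s : Memory}

/-- The state of the memory after the setup phase, apart from the output array and the working
arrays. -/
structure Ready (N : Network (Fin n)) (k κ : ℕ) (bits : ℕ → ℕ) (s : Memory) : Prop where
  bits : s 0 = bits
  size : s 2 0 = n
  seeds : s 2 1 = k
  cost : ∀ u : Fin n, s 3 u = (N.cost u).num
  demand : ∀ v : Fin n, s 5 v * (s 9 0 / s 6 v) = N.intDemand v
  quality : ∀ v w : Fin n, s 7 (v * n + w) * (s 10 0 / s 8 (v * n + w)) = N.intQuality v w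
  denom : s 11 0 = 2 ^ (3 * n + κ)
  total : s 12 0 = ∑ v, N.intDemand v

theorem Ready.congr (h : Ready N k κ bits s) {s' : Memory}
    (hs : ∀ a, a ≠ 1 → a < 13 → s' a = s a) : Ready N k κ bits s' := by
  have h0 := hs 0 (by omega) (by omega)
  have h2 := hs 2 (by omega) (by omega)
  have h3 := hs 3 (by omega) (by omega)
  have h5 := hs 5 (by omega) (by omega)
  have h6 := hs 6 (by omega) (by omega)
  have h7 := hs 7 (by omega) (by omega)
  have h8 := hs 8 (by omega) (by omega)
  have h9 := hs 9 (by omega) (by omega)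
  have h10 := hs 10 (by omega) (by omega)
  have h11 := hs 11 (by omega) (by omega)
  have h12 := hs 12 (by omega) (by omega)
  obtain ⟨g0, g2, g2', g3, g5, g7, g11, g12⟩ := h
  constructor <;> simp only [h0, h2, h3, h5, h6, h7, h8, h9, h10, h11, h12] <;> assumption

/-- The number `K` is large enough to serve as a bound for the number of bits of all numbers and
for the number of iterations of all loops. -/
structure Fits (N : Network (Fin n)) (κ M L K : ℕ) : Prop where
  size : n * n ≤ L
  demandDen : N.demandDen ≤ 2 ^ L
  qualityDen : N.qualityDen ≤ 2 ^ L
  demand : ∀ v, (N.demand v).num ≤ 2 ^ L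
  quality : ∀ v w, (N.quality v w).num ≤ 2 ^ L
  le : M * (n + 1) + (3 * n + κ) + 6 * L + 2 ≤ K

/-! ### Correctness of the program -/

namespace Fits

variable (hK : Fits N κ M L K)

include hK

theorem n_le : n ≤ L := (Nat.le_mul_self n).trans hK.size

theorem n_lt : n + 1 ≤ 2 ^ L := Nat.lt_two_pow_self.trans_le
  (Nat.pow_le_pow_right two_pos hK.n_le)

theorem lt_two_pow {x e : ℕ} (hx : x ≤ 2 ^ e) (he : e ≤ 6 * L + (3 * n + κ)) : x < 2 ^ K :=
  hx.trans_lt (Nat.pow_lt_pow_right one_lt_two (by have := hK.le; omega))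

theorem intDemand_le (v : Fin n) : N.intDemand v ≤ 2 ^ (2 * L) := by
  rw [two_mul, pow_add]
  exact Nat.mul_le_mul (hK.demand v) ((Nat.div_le_self _ _).trans hK.demandDen)

theorem intQuality_le (v w : Fin n) : N.intQuality v w ≤ 2 ^ (2 * L) := by
  rw [two_mul, pow_add]
  exact Nat.mul_le_mul (hK.quality v w) ((Nat.div_le_self _ _).trans hK.qualityDen)

theorem sum_le {f : Fin n → ℕ} {e : ℕ} (hf : ∀ i, f i ≤ 2 ^ e) : ∑ i, f i ≤ 2 ^ (L + e) := by
  calc ∑ i, f i ≤ ∑ i : Fin n, 2 ^ e := sum_le_sum fun i _ => hf i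
    _ = n * 2 ^ e := by simp
    _ ≤ 2 ^ L * 2 ^ e := Nat.mul_le_mul_right _ (by have := hK.n_lt; omega)
    _ = _ := (pow_add _ _ _).symm

theorem le_of_le {x : ℕ} (hx : x ≤ M * (n + 1) + (3 * n + κ) + 6 * L + 1) : x ≤ K := by
  have := hK.le
  omega

theorem samples_le : M ≤ K :=
  hK.le_of_le (by have : M * (n + 1) = M * n + M := by ring
                  omega)

end Fits

/-- Array `a` holds the characteristic function of the set `A`. -/
def Holds (a : ℕ) (A : Finset (Fin n)) (s : Memory) : Prop :=
  ∀ u : Fin n, s a u = if u ∈ A then 1 else 0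

theorem Holds.congr {a : ℕ} {A : Finset (Fin n)} {s' : Memory} (h : Holds a A s)
    (hs : s' a = s a) : Holds a A s' := fun u => by rw [hs]; exact h u

theorem Holds.sum_mul {a : ℕ} {A : Finset (Fin n)} (h : Holds a A s) (f : Fin n → ℕ) :
    ∑ w : Fin n, s a w * f w = ∑ w ∈ A, f w := by
  simp [h _]

theorem Holds.insert {a : ℕ} {A : Finset (Fin n)} (h : Holds a A s) (u : Fin n) :
    Holds a (insert u A) (s.set a u 1) := by
  intro v
  rw [Memory.set_apply, h v]
  rcases eq_or_ne v u with rfl | hv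
  · simp
  · simp [hv, Fin.val_inj]

theorem Ready.eval_size (h : Ready N k κ bits s) : Greedy.size.eval s = n := h.size

theorem Ready.eval_digits (h : Ready N k κ bits s) : (digits κ).eval s = 3 * n + κ := by
  simp [digits, h.eval_size]

theorem Ready.eval_demand (h : Ready N k κ bits s) {e : Expr} {v : Fin n} (he : e.eval s = v) :
    (Greedy.demand e).eval s = N.intDemand v := by
  simp [Greedy.demand, he, h.demand]

theorem Ready.eval_quality (h : Ready N k κ bits s) {e f : Expr} {v w : Fin n}
    (he : e.eval s = v) (hf : f.eval s = w) :
    (Greedy.quality e f).eval s = N.intQuality v w := by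
  simp [Greedy.quality, he, hf, h.quality, h.eval_size]

section

variable (hK : Fits N κ M L K) (hbits : ∀ i, bits i ≤ 1)

include hK

theorem runs_load (hs : Ready N k κ bits s) {A : Finset (Fin n)} (hA : Holds 13 A s)
    {u : Fin n} (hu : s 26 0 = u) :
    Runs K load s (fun s' => s' 14 0 = N.intLoad (2 ^ (3 * n + κ)) A u) := by
  have hnK : n ≤ K := hK.le_of_le (by have := hK.n_le; omega)
  refine (Runs.sum (c := 0) (fun v => 2 ^ (3 * n + κ) * N.intDemand v * N.intQuality v u /
    (N.intQuality v u + ∑ w ∈ A, N.intQuality v w)) ?_ hnK (by decide) (by decide) (by decide)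
    ?_ rfl ?_).mono fun s' _ h => ?_
  · exact (hs.congr fun a _ ha => Memory.set_of_ne _ (by omega) _ _).eval_size
  · rw [zero_add]
    refine hK.lt_two_pow (hK.sum_le (e := 3 * n + κ + 2 * L + 2 * L) fun v => ?_) (by omega)
    refine (Nat.div_le_self _ _).trans ?_
    rw [pow_add _ _ (2 * L), pow_add _ _ (2 * L)]
    gcongr
    · exact hK.intDemand_le v
    · exact hK.intQuality_le v u
  · intro v s₁ hf hv
    have hs₁ : Ready N k κ bits s₁ := hs.congr fun a _ ha => by
      refine hf a (by omega) (by omega) ?_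
      simp only [Prog.accumulate, Prog.forLoop, Prog.writes, List.cons_append, List.nil_append,
        List.mem_cons, List.not_mem_nil, or_false, not_or]
      omega
    have hA₁ : Holds 13 A s₁ := hA.congr (hf 13 (by decide) (by decide) (by decide))
    have hu₁ : s₁ 26 0 = u := by rw [hf 26 (by decide) (by decide) (by decide), hu]
    refine (Runs.sum (c := N.intQuality v u) (fun w => s₁ 13 w * N.intQuality v w) ?_ hnK
      (by decide) (by decide) (by decide) ?_ ?_ ?_).mono fun s₂ hf₂ h₂ => ?_
    · exact (hs₁.congr fun a _ ha => Memory.set_of_ne _ (by omega) _ _).eval_size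
    · refine hK.lt_two_pow (e := L + 2 * L) ?_ (by omega)
      rw [pow_add]
      refine le_trans ?_ (Nat.mul_le_mul_right _ hK.n_lt)
      rw [add_mul, one_mul, add_comm]
      refine Nat.add_le_add ?_ (hK.intQuality_le v u)
      calc ∑ w : Fin n, s₁ 13 w * N.intQuality v w ≤ ∑ w : Fin n, 2 ^ (2 * L) := by
            refine sum_le_sum fun w _ => ?_
            rw [hA₁ w]
            split_ifs
            · rw [one_mul]
              exact hK.intQuality_le v w
            · simp
        _ = n * 2 ^ (2 * L) := by simp
    · exact hs₁.eval_quality (by simpa using hv) (by simpa using hu₁)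
    · intro w s₂ hf₂ hw
      have hs₂ : Ready N k κ bits s₂ := hs₁.congr fun a _ ha =>
        hf₂ a (by omega) (by omega) (by simp [Prog.writes])
      have hv₂ : s₂ 27 0 = v := by rw [hf₂ 27 (by decide) (by decide) (by decide), hv]
      refine .skip ?_
      rw [Expr.eval_mul, Expr.eval_get, Expr.eval_var, hw,
        hs₂.eval_quality (v := v) (w := w) (by simpa using hv₂) (by simpa using hw),
        hf₂ 13 (by decide) (by decide) (by decide)]
    · have hs₂ : Ready N k κ bits s₂ := hs₁.congr fun a _ ha => by
        refine hf₂ a ?_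
        simp only [Prog.accumulate, Prog.forLoop, Prog.writes, List.cons_append, List.nil_append,
          List.mem_cons, List.not_mem_nil, or_false, not_or]
        omega
      have hv₂ : (Expr.var 27).eval s₂ = v := by
        rw [Expr.eval_var, hf₂ 27 (by decide), hv]
      have hu₂ : (Expr.var 26).eval s₂ = u := by
        rw [Expr.eval_var, hf₂ 26 (by decide), hu₁]
      rw [Expr.eval_div, Expr.eval_mul, Expr.eval_mul, hs₂.eval_demand hv₂,
        hs₂.eval_quality hv₂ hu₂, Expr.eval_var, Expr.eval_var, hs₂.denom, h₂, hA₁.sum_mul]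
  · rw [h, zero_add]
    rfl

include hbits

theorem runs_sample (hs : Ready N k κ bits s) {u t : ℕ} (hu : s 26 0 = u) (ht : s 23 0 = t) :
    Runs K (sample κ) s (fun s' => s' 16 0 = sampleValue bits n (3 * n + κ) t u) := by
  refine (Runs.accumulate (fun j => ∑ l ∈ range (3 * n + κ - j),
    bits (j + l + (3 * n + κ) * (u + n * t)) * 2 ^ l) (N := 3 * n + κ) ?_
    (hK.le_of_le (by omega)) (by decide) (by decide) ?_ ?_ ?_).mono fun s' _ h => ?_
  · exact (hs.congr fun a _ ha => Memory.set_of_ne _ (by omega) _ _).eval_digits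
  · intro j hj
    refine hK.lt_two_pow (sum_bits_lt (fun i => hbits _) _).le (by omega)
  · simp
  · intro j hj s₁ hf hj₁ hG
    have hs₁ : Ready N k κ bits s₁ := hs.congr fun a _ ha =>
      hf a (by omega) (by omega) (by simp [Prog.writes])
    refine .skip ?_
    have hsub : 3 * n + κ - j = (3 * n + κ - (j + 1)) + 1 := by omega
    simp only [Expr.eval_add, Expr.eval_mul, Expr.eval_var, Expr.eval_get, Expr.eval_const,
      hs₁.eval_size, hs₁.eval_digits, hG, hs₁.bits, hj₁, hf 26 (by decide) (by decide) (by decide),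
      hf 23 (by decide) (by decide) (by decide), hu, ht]
    rw [hsub, sum_range_succ', sum_mul]
    simp only [pow_zero, mul_one, add_zero, pow_succ]
    congr 1
    refine sum_congr rfl fun l _ => ?_
    rw [mul_assoc, show j + 1 + l = j + (l + 1) by ring]
  · simpa [sampleValue] using h

theorem runs_update (hs : Ready N k κ bits s) {A : Finset (Fin n)} (hA : Holds 13 A s)
    {u : Fin n} {t : ℕ} (hu : s 26 0 = u) (ht : s 23 0 = t) :
    Runs K (update κ) s (fun s' => ∃ A', Holds 13 A' s' ∧ A ⊆ A' ∧
      (N.intResponse (2 ^ (3 * n + κ)) u (sampleValue bits n (3 * n + κ) t u) A → u ∈ A') ∧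
      ∀ v ∈ A', v ∈ A ∨ v = u ∧
        N.intResponse (2 ^ (3 * n + κ)) u (sampleValue bits n (3 * n + κ) t u) A) := by
  refine (runs_load hK hs hA hu).seq fun s₁ hf₁ h₁ => ?_
  rw [writes_load] at hf₁
  have hs₁ : Ready N k κ bits s₁ := hs.congr fun a _ ha => hf₁ a (by simp; omega)
  have hA₁ : Holds 13 A s₁ := hA.congr (hf₁ 13 (by decide))
  have hu₁ : s₁ 26 0 = u := by rw [hf₁ 26 (by decide), hu]
  have ht₁ : s₁ 23 0 = t := by rw [hf₁ 23 (by decide), ht]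
  refine (runs_sample hK hbits hs₁ hu₁ ht₁).seq fun s₂ hf₂ h₂ => ?_
  rw [writes_sample] at hf₂
  have hs₂ : Ready N k κ bits s₂ := hs₁.congr fun a _ ha => hf₂ a (by simp; omega)
  have hA₂ : Holds 13 A s₂ := hA₁.congr (hf₂ 13 (by decide))
  have hu₂ : s₂ 26 0 = u := by rw [hf₂ 26 (by decide), hu₁]
  rw [← hf₂ 14 (by decide)] at h₁
  have he : (Expr.get 3 (.var 26) * (Expr.var 14).less (.var 16 * .var 12)).eval s₂ ≠ 0 ↔
      N.intResponse (2 ^ (3 * n + κ)) u (sampleValue bits n (3 * n + κ) t u) A := by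
    rw [Network.intResponse_iff]
    simp [hu₂, hs₂.cost, h₁, h₂, hs₂.total, and_comm]
  refine .ite (fun h => .assign ?_ ?_) (fun h => .skip ?_)
  · exact hK.lt_two_pow (e := 0) (by simp) (by omega)
  · rw [he] at h
    refine ⟨insert u A, ?_, subset_insert u A, fun _ => mem_insert_self u A, fun v hv => ?_⟩
    · have := hA₂.insert u
      simpa [hu₂] using this
    · rcases mem_insert.1 hv with rfl | hv
      · exact Or.inr ⟨rfl, h⟩
      · exact Or.inl hv
  · exact ⟨A, hA₂, Subset.rfl, fun h' => absurd h (he.2 h'), fun v hv => Or.inl hv⟩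

/-- Within a round the nodes are updated one after the other, and not simultaneously, but both ways
to proceed end in the least stable set. -/
theorem runs_cascade (hs : Ready N k κ bits s) {S : Finset (Fin n)} (hS : Holds 1 S s)
    {x : Fin n} {t : ℕ} (hx : s 22 0 = x) (ht : s 23 0 = t) :
    Runs K (cascade κ) s (Holds 13 (N.intSpread (2 ^ (3 * n + κ))
      (fun u => sampleValue bits n (3 * n + κ) t u) (insert x S))) := by
  have hnK : n ≤ K := hK.le_of_le (by have := hK.n_le; omega)
  refine Runs.seq (R := Holds 13 S) ?_ fun s₁ hf₁ hS₁ => ?_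
  · refine (Runs.forLoop (I := fun j s' => ∀ u : Fin n, j ≤ (u : ℕ) →
      s' 13 u = if u ∈ S then 1 else 0) hs.eval_size hnK (by decide) ?_ ?_).mono
      fun s' _ h u => h u (Nat.zero_le _)
    · intro u hu
      omega
    · intro j hj s₁ hf hI
      have h1 : s₁ 1 = s 1 := hf 1 (by decide) (by decide)
      have hval : (Expr.get 1 (.var 24)).eval (s₁.set 24 0 j) =
          if (⟨j, hj⟩ : Fin n) ∈ S then 1 else 0 := by
        rw [Expr.eval_get, Expr.eval_var, Memory.set_same, Memory.set_of_ne _ (by decide), h1]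
        exact hS ⟨j, hj⟩
      refine .assign ?_ ?_
      · rw [hval]
        refine hK.lt_two_pow (e := 0) ?_ (by omega)
        split_ifs <;> simp
      · intro u hu
        rw [hval, Memory.set_apply, Expr.eval_var, Memory.set_same]
        rcases eq_or_lt_of_le hu with h | h
        · obtain rfl : u = ⟨j, hj⟩ := Fin.ext h.symm
          rw [if_pos rfl]
        · rw [if_neg (by omega), Memory.set_of_ne _ (by decide), hI u h]
  rw [show (Prog.forLoop 24 size (.assign 13 (.var 24) (.get 1 (.var 24)))).writes =
    [24, 24, 13] from rfl] at hf₁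
  have hs₁ : Ready N k κ bits s₁ := hs.congr fun a _ ha => hf₁ a (by simp; omega)
  have hx₁ : s₁ 22 0 = x := by rw [hf₁ 22 (by decide), hx]
  have ht₁ : s₁ 23 0 = t := by rw [hf₁ 23 (by decide), ht]
  refine Runs.seq (R := Holds 13 (insert x S)) (.assign ?_ ?_) fun s₂ hf₂ hS₂ => ?_
  · exact hK.lt_two_pow (e := 0) (by simp) (by omega)
  · simpa [hx₁] using hS₁.insert x
  rw [show (Prog.assign 13 (.var 22) (.const 1)).writes = [13] from rfl] at hf₂
  have hs₂ : Ready N k κ bits s₂ := hs₁.congr fun a _ ha => hf₂ a (by simp; omega)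
  have ht₂ : s₂ 23 0 = t := by rw [hf₂ 23 (by decide), ht₁]
  let R : Fin n → Response (Fin n) := fun u =>
    N.intResponse (2 ^ (3 * n + κ)) u (sampleValue bits n (3 * n + κ) t u)
  change Runs K _ s₂ (Holds 13 (spread R (insert x S)))
  have hwr : (Prog.forLoop 26 size (update κ)).writes =
    [26, 26, 14, 27, 27, 15, 28, 28, 15, 14, 16, 29, 29, 16, 13] := rfl
  -- every round starts with a stable set or adds a node, so that `n` rounds suffice
  refine (Runs.forLoop (I := fun j s' => ∃ A : Finset (Fin n), Holds 13 A s' ∧ insert x S ⊆ A ∧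
    A ⊆ spread R (insert x S) ∧ (IsStable R A ∨ n ≤ A.card + j)) hs₂.eval_size hnK
    (by rw [hwr]; decide) ?_ ?_).mono ?_
  · exact ⟨insert x S, hS₂.congr (Memory.set_of_ne _ (by decide) _ _), Subset.rfl,
      subset_spread _ _, Or.inr (by omega)⟩
  · rintro j hj s₃ hf₃ ⟨A, hA, hSA, hAR, hcard⟩
    rw [hwr] at hf₃
    have hs₃ : Ready N k κ bits (s₃.set 25 0 j) := hs₂.congr fun a _ ha => by
      rw [Memory.set_of_ne _ (by omega), hf₃ a (by omega) (by simp; omega)]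
    have ht₃ : s₃.set 25 0 j 23 0 = t := by
      rw [Memory.set_of_ne _ (by decide), hf₃ 23 (by decide) (by decide), ht₂]
    refine (Runs.forLoop (I := fun i s' => ∃ A' : Finset (Fin n), Holds 13 A' s' ∧ A ⊆ A' ∧
      A' ⊆ spread R (insert x S) ∧ ∀ u : Fin n, i ≤ (u : ℕ) → R u A → u ∈ A') hs₃.eval_size hnK
      (by rw [writes_update]; decide) ?_ ?_).mono ?_
    · refine ⟨A, hA.congr ?_, Subset.rfl, hAR, fun u hu => ?_⟩
      · rw [Memory.set_of_ne _ (by decide), Memory.set_of_ne _ (by decide)]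
      · omega
    · rintro i hi s₄ hf₄ ⟨A', hA', hAA', hA'R, hresp⟩
      rw [writes_update] at hf₄
      have hs₄ : Ready N k κ bits (s₄.set 26 0 i) := hs₃.congr fun a _ ha => by
        rw [Memory.set_of_ne _ (by omega), hf₄ a (by omega) (by simp; omega)]
      have ht₄ : s₄.set 26 0 i 23 0 = t := by
        rw [Memory.set_of_ne _ (by decide), hf₄ 23 (by decide) (by decide), ht₃]
      refine (runs_update hK hbits hs₄ (hA'.congr (Memory.set_of_ne _ (by decide) _ _))
        (u := ⟨i, hi⟩) (Memory.set_same _ _ _ _) ht₄).mono ?_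
      rintro s₅ - ⟨A'', hA'', hsub, hin, hout⟩
      refine ⟨A'', hA'', hAA'.trans hsub, fun v hv => ?_, fun u hu huA => ?_⟩
      · rcases hout v hv with h | ⟨rfl, h⟩
        · exact hA'R h
        · exact isStable_spread R _ _ ((R _).monotone hA'R h)
      · rcases eq_or_lt_of_le hu with h | h
        · obtain rfl : u = ⟨i, hi⟩ := Fin.ext h.symm
          exact hin ((R _).monotone hAA' huA)
        · exact hsub (hresp u h huA)
    · rintro s₄ - ⟨A', hA', hAA', hA'R, hresp⟩
      refine ⟨A', hA', hSA.trans hAA', hA'R, ?_⟩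
      by_cases hst : IsStable R A
      · have : A' = A := subset_antisymm (hA'R.trans (spread_subset hSA hst)) hAA'
        exact Or.inl (this ▸ hst)
      · right
        have hne : A ≠ A' := by
          rintro rfl
          exact hst fun u hu => hresp u (Nat.zero_le _) hu
        have := card_lt_card (lt_of_le_of_ne hAA' hne)
        have := hcard.resolve_left hst
        omega
  · rintro s₃ - ⟨A, hA, hSA, hAR, hcard⟩
    have hst : IsStable R A := by
      rcases hcard with h | h
      · exact h
      · have : A = univ := by
          rw [← card_eq_iff_eq_univ]
          exact le_antisymm (card_le_univ _) (by simpa using h)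
        rw [this]
        exact fun u _ => mem_univ u
    rwa [subset_antisymm (spread_subset hSA hst) hAR]

end

variable {μ : ℕ}

/-- The sum of the sizes of the spreads of `S` over `M` samples, for tradeoff factors with `b`
binary digits. -/
noncomputable def totalSpread (N : Network (Fin n)) (b M : ℕ) (bits : ℕ → ℕ)
    (S : Finset (Fin n)) : ℕ :=
  ∑ t : Fin M, (N.intSpread (2 ^ b) (fun u => sampleValue bits n b t u) S).card

theorem totalSpread_le (b : ℕ) (S : Finset (Fin n)) : totalSpread N b M bits S ≤ M * n := by
  calc totalSpread N b M bits S ≤ ∑ t : Fin M, n :=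
        sum_le_sum fun t _ => (card_le_univ _).trans (by simp)
    _ = M * n := by simp

section

variable (hbits : ∀ i, bits i ≤ 1) (hK : Fits N κ (μ * (n * n * n)) L K)

include hK in
theorem one_add_totalSpread_lt (S : Finset (Fin n)) :
    1 + totalSpread N (3 * n + κ) (μ * (n * n * n)) bits S < 2 ^ K := by
  refine lt_of_le_of_lt (hK.le_of_le ?_) Nat.lt_two_pow_self
  have := totalSpread_le (N := N) (bits := bits) (M := μ * (n * n * n)) (3 * n + κ) S
  rw [mul_add (μ * (n * n * n)) n 1]
  omega

include hbits hK

theorem runs_evaluate (hs : Ready N k κ bits s) {S : Finset (Fin n)} (hS : Holds 1 S s)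
    {x : Fin n} (hx : s 22 0 = x) :
    Runs K (evaluate κ μ) s (fun s' =>
      s' 17 0 = 1 + totalSpread N (3 * n + κ) (μ * (n * n * n)) bits (insert x S)) := by
  have hnK : n ≤ K := hK.le_of_le (by have := hK.n_le; omega)
  have hwr : (Prog.seq (cascade κ) (.accumulate 31 30 (.const 0) size .skip
      (.var 31 + .get 13 (.var 30)))).writes = (cascade κ).writes ++ [31, 30, 30, 31] := rfl
  refine Runs.sum (N := μ * (n * n * n)) (c := 1) (fun t => (N.intSpread (2 ^ (3 * n + κ))
    (fun u => sampleValue bits n (3 * n + κ) t u) (insert x S)).card) ?_ hK.samples_le ?_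
    (by decide) ?_ (one_add_totalSpread_lt hK (insert x S)) rfl ?_
  · have := (hs.congr (s' := s.set 17 0 1)
      fun a _ ha => Memory.set_of_ne _ (by omega) _ _).eval_size
    simp only [samples, Expr.eval_mul, Expr.eval_const, this]
  · rw [hwr, writes_cascade]
    decide
  · rw [hwr, writes_cascade]
    decide
  · intro t s₁ hf ht
    rw [hwr, writes_cascade] at hf
    have hs₁ : Ready N k κ bits s₁ := hs.congr fun a _ ha =>
      hf a (by omega) (by omega) (by simp; omega)
    have hS₁ : Holds 1 S s₁ := hS.congr (hf 1 (by decide) (by decide) (by decide))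
    have hx₁ : s₁ 22 0 = x := by rw [hf 22 (by decide) (by decide) (by decide), hx]
    refine (runs_cascade hK hbits hs₁ hS₁ hx₁ ht).seq fun s₂ hf₂ h₂ => ?_
    rw [writes_cascade] at hf₂
    have hs₂ : Ready N k κ bits s₂ := hs₁.congr fun a _ ha => hf₂ a (by simp; omega)
    have hsum := h₂.sum_mul (fun _ => 1)
    simp only [mul_one, sum_const, smul_eq_mul] at hsum
    refine (Runs.sum (c := 0) (fun u : Fin n => s₂ 13 u) ?_ hnK (by decide) (by decide)
      (by decide) ?_ rfl ?_).mono fun s₃ _ h => ?_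
    · exact (hs₂.congr (s' := s₂.set 31 0 ((Expr.const 0).eval s₂))
        fun a _ ha => Memory.set_of_ne _ (by omega) _ _).eval_size
    · rw [hsum, zero_add]
      refine hK.lt_two_pow (e := L) ((card_le_univ _).trans ?_) (by omega)
      have := hK.n_lt
      simp only [Fintype.card_fin]
      omega
    · intro u s₃ hf₃ hu
      refine .skip ?_
      rw [Expr.eval_get, Expr.eval_var, hu, hf₃ 13 (by decide) (by decide) (by decide)]
    · rw [Expr.eval_var, h, zero_add, hsum]

theorem runs_candidate (hs : Ready N k κ bits s) {S : Finset (Fin n)} (hS : Holds 1 S s)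
    {x : Fin n} (hx : s 22 0 = x) :
    Runs K (candidate κ μ) s (fun s' =>
      (x ∈ S → s' = s) ∧ (x ∉ S →
        (1 + totalSpread N (3 * n + κ) (μ * (n * n * n)) bits (insert x S) ≤ s 18 0 ∧
          s' 18 0 = s 18 0 ∧ s' 19 0 = s 19 0) ∨
        (s 18 0 < 1 + totalSpread N (3 * n + κ) (μ * (n * n * n)) bits (insert x S) ∧
          s' 18 0 = 1 + totalSpread N (3 * n + κ) (μ * (n * n * n)) bits (insert x S) ∧
          s' 19 0 = x))) := by
  have he : (Expr.get 1 (.var 22)).eval s = if x ∈ S then 1 else 0 := by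
    simp [hx, hS x]
  by_cases hxS : x ∈ S
  · refine .ite (fun _ => .skip ⟨fun _ => rfl, fun h => absurd hxS h⟩) fun h => ?_
    rw [he, if_pos hxS] at h
    exact absurd h one_ne_zero
  refine .ite (fun h => absurd (by rw [he, if_neg hxS]) h) fun _ => ?_
  refine (runs_evaluate hbits hK hs hS hx).seq fun s₁ hf₁ h₁ => ?_
  rw [writes_evaluate, writes_cascade] at hf₁
  have h18 := hf₁ 18 (by decide)
  have h19 := hf₁ 19 (by decide)
  have h22 := hf₁ 22 (by decide)
  refine .ite (fun h => ?_) fun h => .skip ?_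
  · have hlt : s 18 0 < 1 + totalSpread N (3 * n + κ) (μ * (n * n * n)) bits (insert x S) := by
      by_contra hle
      simp [h18, h₁, hle] at h
    refine Runs.seq (R := fun s₂ => s₂ = s₁.set 18 0 (s₁ 17 0)) (.assign ?_ rfl) ?_
    · rw [Expr.eval_var, h₁]
      exact one_add_totalSpread_lt hK _
    · rintro _ - rfl
      refine .assign ?_ ⟨fun h => absurd h hxS, fun _ => Or.inr ⟨hlt, ?_, ?_⟩⟩
      · rw [Expr.eval_var, Memory.set_of_ne _ (by decide), h22, hx]
        refine hK.lt_two_pow (e := L) ?_ (by omega)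
        have := hK.n_lt
        omega
      · rw [Memory.set_of_ne _ (by decide), Memory.set_same, h₁]
      · rw [Expr.eval_const, Memory.set_same, Expr.eval_var, Memory.set_of_ne _ (by decide),
          h22, hx]
  · refine ⟨fun h => absurd h hxS, fun _ => Or.inl ⟨?_, by rw [h18], by rw [h19]⟩⟩
    by_contra hle
    simp [h18, h₁, not_le.1 hle] at h

/-- The main loop selects a greedy set for the empirical average of the spread. -/
theorem runs_selection (hs : Ready N k κ bits s) (hk : k ≤ n) (h1 : ∀ i, s 1 i = 0) :
    Runs K (.forLoop 21 seeds <| .seq (.assign 18 (.const 0) (.const 0)) <|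
      .seq (.forLoop 22 size (candidate κ μ)) (.assign 1 (.var 19) (.const 1))) s
      (fun s' => ∃ S : Finset (Fin n), Holds 1 S s' ∧
        IsGreedy (fun S => 1 + totalSpread N (3 * n + κ) (μ * (n * n * n)) bits S) k S) := by
  set f : Finset (Fin n) → ℕ :=
    fun S => 1 + totalSpread N (3 * n + κ) (μ * (n * n * n)) bits S with hfdef
  have hnK : n ≤ K := hK.le_of_le (by have := hK.n_le; omega)
  have hwr : (Prog.seq (.assign 18 (.const 0) (.const 0)) <|
      .seq (.forLoop 22 size (candidate κ μ)) (.assign 1 (.var 19) (.const 1))).writes =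
      18 :: 22 :: 22 :: (candidate κ μ).writes ++ [1] := rfl
  refine (Runs.forLoop (e := seeds) (I := fun j s' => ∃ S : Finset (Fin n), Holds 1 S s' ∧
    IsGreedy f (k - j) S) (show seeds.eval s = k from hs.seeds) (hk.trans hnK) ?_ ?_ ?_).mono
    fun s' _ h => by simpa using h
  · rw [hwr, writes_candidate, writes_evaluate, writes_cascade]
    decide
  · refine ⟨∅, fun u => ?_, ?_⟩
    · rw [Memory.set_of_ne _ (by decide), h1]
      simp
    · rw [Nat.sub_self]
      exact .zero
  rintro j hj s₁ hf₁ ⟨S, hS, hgr⟩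
  rw [hwr, writes_candidate, writes_evaluate, writes_cascade] at hf₁
  have hs₁ : Ready N k κ bits ((s₁.set 21 0 j).set 18 0 0) := hs.congr fun a h1 ha => by
    rw [Memory.set_of_ne _ (by omega), Memory.set_of_ne _ (by omega),
      hf₁ a (by omega) (by simp; omega)]
  have hS₁ : Holds 1 S ((s₁.set 21 0 j).set 18 0 0) := hS.congr (by
    rw [Memory.set_of_ne _ (by decide), Memory.set_of_ne _ (by decide)])
  refine Runs.seq (R := fun s₂ => s₂ = (s₁.set 21 0 j).set 18 0 0)
    (.assign (by simp) rfl) ?_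
  rintro s₂ - hs₂
  rw [← hs₂] at hs₁ hS₁
  have h18 : s₂ 18 0 = 0 := by rw [hs₂, Memory.set_same]
  refine Runs.seq (R := fun s' => ∃ x : Fin n, s' 19 0 = x ∧ x ∉ S ∧
    ∀ y, y ∉ S → f (insert y S) ≤ f (insert x S)) ?_ ?_
  · refine (Runs.forLoop (I := fun i s' =>
      (∀ y : Fin n, i ≤ (y : ℕ) → y ∉ S → f (insert y S) ≤ s' 18 0) ∧
      (s' 18 0 = 0 ∨ ∃ x : Fin n, s' 19 0 = x ∧ x ∉ S ∧ s' 18 0 = f (insert x S)))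
      hs₁.eval_size hnK ?_ ?_ ?_).mono ?_
    · rw [writes_candidate, writes_evaluate, writes_cascade]
      decide
    · refine ⟨fun y hy => by omega, Or.inl ?_⟩
      rw [Memory.set_of_ne _ (by decide), h18]
    · rintro i hi s₃ hf₃ ⟨hmax, hbest⟩
      rw [writes_candidate, writes_evaluate, writes_cascade] at hf₃
      have hs₃ : Ready N k κ bits (s₃.set 22 0 i) := hs₁.congr fun a h1 ha => by
        rw [Memory.set_of_ne _ (by omega), hf₃ a (by omega) (by simp; omega)]
      have hS₃ : Holds 1 S (s₃.set 22 0 i) := hS₁.congr (by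
        rw [Memory.set_of_ne _ (by decide), hf₃ 1 (by decide) (by decide)])
      refine (runs_candidate hbits hK hs₃ hS₃ (x := ⟨i, hi⟩) (Memory.set_same _ _ _ _)).mono ?_
      rintro s₄ - ⟨hin, hout⟩
      have g18 : (s₃.set 22 0 i) 18 = s₃ 18 := Memory.set_of_ne _ (by decide) _ _
      have g19 : (s₃.set 22 0 i) 19 = s₃ 19 := Memory.set_of_ne _ (by decide) _ _
      by_cases hiS : (⟨i, hi⟩ : Fin n) ∈ S
      · rw [hin hiS, g18, g19]
        refine ⟨fun y hy hyS => hmax y (lt_of_le_of_ne hy ?_) hyS, hbest⟩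
        rintro rfl
        exact hyS hiS
      · rw [g18, g19] at hout
        rcases hout hiS with ⟨hle, h1, h2⟩ | ⟨hlt, h1, h2⟩
        · rw [h1, h2]
          refine ⟨fun y hy hyS => ?_, hbest⟩
          rcases eq_or_lt_of_le hy with h | h
          · obtain rfl : y = ⟨i, hi⟩ := Fin.ext h.symm
            exact hle
          · exact hmax y h hyS
        · rw [h1, h2]
          refine ⟨fun y hy hyS => ?_, Or.inr ⟨⟨i, hi⟩, rfl, hiS, rfl⟩⟩
          rcases eq_or_lt_of_le hy with h | h
          · obtain rfl : y = ⟨i, hi⟩ := Fin.ext h.symm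
            exact le_rfl
          · exact (hmax y h hyS).trans hlt.le
    · rintro s₃ - ⟨hmax, hbest⟩
      have hcard : S.card < (univ : Finset (Fin n)).card := by
        rw [hgr.card_eq, card_univ, Fintype.card_fin]
        omega
      obtain ⟨y, -, hy⟩ := exists_mem_notMem_of_card_lt_card hcard
      -- every value of `f` is positive, so the best value is attained by some node
      have hpos : 0 < s₃ 18 0 :=
        lt_of_lt_of_le (by simp only [hfdef]; omega) (hmax y (Nat.zero_le _) hy)
      obtain ⟨x, hx, hxS, hxf⟩ := hbest.resolve_left hpos.ne'
      exact ⟨x, hx, hxS, fun y hy => (hmax y (Nat.zero_le _) hy).trans_eq hxf⟩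
  · rintro s₃ hf₃ ⟨x, hx, hxS, hmax⟩
    rw [show (Prog.forLoop 22 size (candidate κ μ)).writes =
      22 :: 22 :: (candidate κ μ).writes from rfl, writes_candidate, writes_evaluate,
      writes_cascade] at hf₃
    refine .assign ?_ ⟨insert x S, ?_, ?_⟩
    · exact hK.lt_two_pow (e := 0) (by simp) (by omega)
    · rw [Expr.eval_var, Expr.eval_const, hx]
      exact (hS₁.congr (hf₃ 1 (by decide))).insert x
    · rw [show k - j = k - (j + 1) + 1 by omega]
      exact .succ hgr hxS hmax

end

/-- The memory contains the input and the random bits. -/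
structure Initial (N : Network (Fin n)) (k : ℕ) (bits : ℕ → ℕ) (s : Memory) : Prop where
  bits : s 0 = bits
  output : ∀ i, s 1 i = 0
  size : s 2 0 = n
  seeds : s 2 1 = k
  costNum : ∀ u : Fin n, s 3 u = (N.cost u).num
  demandNum : ∀ v : Fin n, s 5 v = (N.demand v).num
  demandDen : ∀ v : Fin n, s 6 v = (N.demand v).den
  qualityNum : ∀ i : Fin (n * n), s 7 i = (N.quality i.divNat i.modNat).num
  qualityDen : ∀ i : Fin (n * n), s 8 i = (N.quality i.divNat i.modNat).den

theorem Initial.congr (h : Initial N k bits s) {s' : Memory} (hs : ∀ a, a < 9 → s' a = s a) :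
    Initial N k bits s' := by
  have h0 := hs 0 (by omega)
  have h1 := hs 1 (by omega)
  have h2 := hs 2 (by omega)
  have h3 := hs 3 (by omega)
  have h5 := hs 5 (by omega)
  have h6 := hs 6 (by omega)
  have h7 := hs 7 (by omega)
  have h8 := hs 8 (by omega)
  obtain ⟨g0, g1, g2, g2', g3, g5, g6, g7, g8⟩ := h
  constructor <;> simp only [h0, h1, h2, h3, h5, h6, h7, h8] <;> assumption

theorem divNat_modNat_prod (v w : Fin n) :
    (finProdFinEquiv (v, w)).divNat = v ∧ (finProdFinEquiv (v, w)).modNat = w := by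
  have h := finProdFinEquiv.symm_apply_apply (v, w)
  exact ⟨congrArg Prod.fst h, congrArg Prod.snd h⟩

theorem Initial.qualityNum_apply (h : Initial N k bits s) (v w : Fin n) :
    s 7 (v * n + w) = (N.quality v w).num := by
  have := h.qualityNum (finProdFinEquiv (v, w))
  rw [(divNat_modNat_prod v w).1, (divNat_modNat_prod v w).2, finProdFinEquiv_apply_val] at this
  rw [← this]
  congr 1
  ring

theorem Initial.qualityDen_apply (h : Initial N k bits s) (v w : Fin n) :
    s 8 (v * n + w) = (N.quality v w).den := by
  have := h.qualityDen (finProdFinEquiv (v, w))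
  rw [(divNat_modNat_prod v w).1, (divNat_modNat_prod v w).2, finProdFinEquiv_apply_val] at this
  rw [← this]
  congr 1
  ring

theorem qualityDen_eq (N : Network (Fin n)) :
    ∏ i : Fin (n * n), (N.quality i.divNat i.modNat).den = N.qualityDen := by
  rw [Network.qualityDen, ← Fintype.prod_prod_type', ← finProdFinEquiv.symm.prod_comp]
  rfl

theorem runs_setup (hK : Fits N κ M L K) (hs : Initial N k bits s) :
    Runs K (setup κ) s (fun s' => Ready N k κ bits s' ∧ ∀ i, s' 1 i = 0) := by
  have hnK : n ≤ K := hK.le_of_le (by have := hK.n_le; omega)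
  refine Runs.seq (R := fun s' => s' 9 0 = N.demandDen) ?_ fun s₁ hf₁ h₁ => ?_
  · refine Runs.prod (fun v => (N.demand v).den) (fun v => (N.demand v).den_pos) ?_ hnK (by decide)
      (hK.lt_two_pow hK.demandDen (by omega)) fun v s' hf hv => ?_
    · exact (hs.congr (s' := s.set 9 0 1) fun a ha => Memory.set_of_ne _ (by omega) _ _).size
    · rw [Expr.eval_get, Expr.eval_var, hv, hf 6 (by decide) (by decide), hs.demandDen]
  rw [show (Prog.accumulate 9 20 (.const 1) size .skip
    (.var 9 * .get 6 (.var 20))).writes = [9, 20, 20, 9] from rfl] at hf₁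
  have hs₁ : Initial N k bits s₁ := hs.congr fun a ha => hf₁ a (by simp; omega)
  refine Runs.seq (R := fun s' => s' 10 0 = N.qualityDen) ?_ fun s₂ hf₂ h₂ => ?_
  · rw [← qualityDen_eq]
    refine Runs.prod (fun i : Fin (n * n) => (N.quality i.divNat i.modNat).den)
      (fun i => NNRat.den_pos _) ?_ (hK.le_of_le (by have := hK.size; omega)) (by decide)
      (by rw [qualityDen_eq]; exact hK.lt_two_pow hK.qualityDen (by omega)) fun i s' hf hi => ?_
    · have := (hs₁.congr (s' := s₁.set 10 0 1)
        fun a ha => Memory.set_of_ne _ (by omega) _ _).size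
      simp [size, this]
    · rw [Expr.eval_get, Expr.eval_var, hi, hf 8 (by decide) (by decide), hs₁.qualityDen]
  rw [show (Prog.accumulate 10 20 (.const 1) (size * size) .skip
    (.var 10 * .get 8 (.var 20))).writes = [10, 20, 20, 10] from rfl] at hf₂
  have hs₂ : Initial N k bits s₂ := hs₁.congr fun a ha => hf₂ a (by simp; omega)
  rw [← hf₂ 9 (by decide)] at h₁
  refine Runs.seq (R := fun s' => s' 11 0 = 2 ^ (3 * n + κ)) ?_ fun s₃ hf₃ h₃ => ?_
  · refine Runs.accumulate (fun j => 2 ^ (3 * n + κ - j)) (N := 3 * n + κ) ?_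
      (hK.le_of_le (by omega)) (by decide) (by decide) ?_ ?_ ?_
    · have := (hs₂.congr (s' := s₂.set 11 0 1)
        fun a ha => Memory.set_of_ne _ (by omega) _ _).size
      simp only [digits, size, Expr.eval_add, Expr.eval_mul, Expr.eval_const, Expr.eval_var, this]
    · intro j _
      exact hK.lt_two_pow le_rfl (by omega)
    · simp
    · intro j hj s' _ _ h
      refine .skip ?_
      rw [Expr.eval_mul, Expr.eval_var, Expr.eval_const, h, ← pow_succ]
      congr 1
      omega
  rw [show (Prog.accumulate 11 20 (.const 1) (digits κ) .skip
    (.var 11 * .const 2)).writes = [11, 20, 20, 11] from rfl] at hf₃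
  have hs₃ : Initial N k bits s₃ := hs₂.congr fun a ha => hf₃ a (by simp; omega)
  rw [← hf₃ 9 (by decide)] at h₁
  rw [← hf₃ 10 (by decide)] at h₂
  refine (Runs.sum (c := 0) (fun v => N.intDemand v) ?_ hnK (by decide) (by decide) (by decide)
    ?_ rfl ?_).mono fun s₄ hf₄ h₄ => ?_
  · exact (hs₃.congr (s' := s₃.set 12 0 ((Expr.const 0).eval s₃))
      fun a ha => Memory.set_of_ne _ (by omega) _ _).size
  · rw [zero_add]
    exact hK.lt_two_pow (hK.sum_le hK.intDemand_le) (by omega)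
  · intro v s' hf hv
    have hs' : Initial N k bits s' := hs₃.congr fun a ha =>
      hf a (by omega) (by omega) (by simp [Prog.writes])
    refine .skip ?_
    simp only [demand, Expr.eval_mul, Expr.eval_div, Expr.eval_get, Expr.eval_var, hv,
      hs'.demandNum, hs'.demandDen, hf 9 (by decide) (by decide) (by decide), h₁]
    rfl
  · rw [show (Prog.accumulate 12 20 (.const 0) size .skip
      (.var 12 + demand (.var 20))).writes = [12, 20, 20, 12] from rfl] at hf₄
    have hs₄ : Initial N k bits s₄ := hs₃.congr fun a ha => hf₄ a (by simp; omega)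
    rw [← hf₄ 9 (by decide)] at h₁
    rw [← hf₄ 10 (by decide)] at h₂
    rw [← hf₄ 11 (by decide)] at h₃
    rw [zero_add] at h₄
    refine ⟨⟨hs₄.bits, hs₄.size, hs₄.seeds, hs₄.costNum, fun v => ?_, fun v w => ?_, h₃, h₄⟩,
      hs₄.output⟩
    · rw [hs₄.demandNum, hs₄.demandDen, h₁]
      rfl
    · rw [hs₄.qualityNum_apply, hs₄.qualityDen_apply, h₂]
      rfl

theorem runs_program (hbits : ∀ i, bits i ≤ 1) (hK : Fits N κ (μ * (n * n * n)) L K)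
    (hs : Initial N k bits s) (hk : k ≤ n) :
    Runs K (program κ μ) s (fun s' => ∃ S : Finset (Fin n), Holds 1 S s' ∧
      IsGreedy (fun S => 1 + totalSpread N (3 * n + κ) (μ * (n * n * n)) bits S) k S) :=
  (runs_setup hK hs).seq fun _ _ h => runs_selection hbits hK h.1 hk h.2

theorem outputSet_eq_of_holds {S : Finset (Fin n)} (h : Holds 1 S s) : outputSet n s = S := by
  ext u
  simp [outputSet, h u]

end Greedy

/-! ### The size of the input -/

section Input

variable {n : ℕ} (N : Network (Fin n)) (k : ℕ)

theorem inputSize_encode : inputSize (encode N k) =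
    (n.size + 1) + (k.size + 1) +
    ∑ u, ((N.cost u).num.size + 1) + ∑ u, ((N.cost u).den.size + 1) +
    ∑ v, ((N.demand v).num.size + 1) + ∑ v, ((N.demand v).den.size + 1) +
    ∑ i : Fin (n * n), ((N.quality i.divNat i.modNat).num.size + 1) +
    ∑ i : Fin (n * n), ((N.quality i.divNat i.modNat).den.size + 1) := by
  simp only [inputSize, encode, List.flatten_cons, List.flatten_nil, List.map_append,
    List.map_ofFn, List.sum_append, List.sum_ofFn, List.map_cons, List.map_nil, List.sum_cons,
    List.sum_nil, List.append_nil, Function.comp_apply]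
  ring

theorem le_two_pow_of_size_le {x L : ℕ} (h : x.size ≤ L) : x ≤ 2 ^ L :=
  (Nat.size_le.1 h).le

theorem prod_le_two_pow_sum_size {ι : Type*} (s : Finset ι) (f : ι → ℕ) :
    ∏ i ∈ s, f i ≤ 2 ^ ∑ i ∈ s, ((f i).size + 1) := by
  rw [← prod_pow_eq_pow_sum]
  exact prod_le_prod' fun i _ => le_two_pow_of_size_le (Nat.le_succ _)

theorem le_sum_size {ι : Type*} [Fintype ι] (f : ι → ℕ) (i : ι) :
    (f i).size ≤ ∑ j, ((f j).size + 1) :=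
  (Nat.le_succ _).trans (single_le_sum (f := fun j => (f j).size + 1)
    (fun _ _ => Nat.zero_le _) (mem_univ i))

theorem card_le_sum_size {ι : Type*} [Fintype ι] (f : ι → ℕ) :
    Fintype.card ι ≤ ∑ j, ((f j).size + 1) := by
  rw [sum_add_distrib, sum_const, card_univ]
  simp

theorem fits {κ M K L : ℕ} (hL : L = inputSize (encode N k))
    (hK : M * (n + 1) + (3 * n + κ) + 6 * L + 2 ≤ K) : Greedy.Fits N κ M L K := by
  rw [inputSize_encode] at hL
  have h1 := card_le_sum_size fun i : Fin (n * n) => (N.quality i.divNat i.modNat).num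
  rw [Fintype.card_fin] at h1
  refine ⟨by omega, ?_, ?_, fun v => ?_, fun v w => ?_, hK⟩
  · exact (prod_le_two_pow_sum_size univ fun v => (N.demand v).den).trans
      (Nat.pow_le_pow_right two_pos (by omega))
  · rw [← Greedy.qualityDen_eq]
    exact (prod_le_two_pow_sum_size univ fun i : Fin (n * n) =>
      (N.quality i.divNat i.modNat).den).trans (Nat.pow_le_pow_right two_pos (by omega))
  · have := le_sum_size (fun v => (N.demand v).num) v
    exact le_two_pow_of_size_le (by omega)
  · have := le_sum_size (fun i : Fin (n * n) => (N.quality i.divNat i.modNat).num)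
      (finProdFinEquiv (v, w))
    rw [(Greedy.divNat_modNat_prod v w).1, (Greedy.divNat_modNat_prod v w).2] at this
    exact le_two_pow_of_size_le (by omega)

variable {m : ℕ} (r : Fin m → Bool)

theorem extendBits_le_one (i : ℕ) : extendBits r i ≤ 1 := by
  unfold extendBits
  split_ifs
  · exact Bool.toNat_le _
  · exact Nat.zero_le _

theorem bounded_initialMemory {K : ℕ} (input : List (List ℕ)) (hK : inputSize input + 1 ≤ K) :
    Bounded K (initialMemory input r) := by
  have hpos : 1 < 2 ^ K := Nat.one_lt_two_pow (by omega)
  rintro (_ | _ | a) i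
  · exact (extendBits_le_one r i).trans_lt hpos
  · exact zero_lt_one.trans hpos
  · change (input.getD a []).getD i 0 < 2 ^ K
    rcases lt_or_ge a input.length with ha | ha
    · rw [List.getD_eq_getElem _ _ ha]
      rcases lt_or_ge i input[a].length with hi | hi
      · rw [List.getD_eq_getElem _ _ hi]
        have hmem : input[a][i] ∈ input.flatten :=
          List.mem_flatten.2 ⟨_, List.getElem_mem ha, List.getElem_mem hi⟩
        have := List.single_le_sum (l := input.flatten.map fun x => x.size + 1)
          (fun _ _ => Nat.zero_le _) _ (List.mem_map_of_mem hmem)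
        rw [← Nat.size_le]
        change _ ≤ inputSize input at this
        omega
      · rw [List.getD_eq_default _ _ hi]
        exact Nat.two_pow_pos K
    · rw [List.getD_eq_default _ _ ha]
      exact Nat.two_pow_pos K

theorem getD_ofFn {l : ℕ} (f : Fin l → ℕ) (i : Fin l) : (List.ofFn f).getD i 0 = f i := by
  rw [List.getD_eq_getElem _ _ (by simp), List.getElem_ofFn]

theorem initial_initialMemory :
    Greedy.Initial N k (extendBits r) (initialMemory (encode N k) r) where
  bits := rfl
  output _ := rfl
  size := rfl
  seeds := rfl
  costNum u := getD_ofFn (fun u => (N.cost u).num) u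
  demandNum u := getD_ofFn (fun u => (N.demand u).num) u
  demandDen u := getD_ofFn (fun u => (N.demand u).den) u
  qualityNum i := getD_ofFn (fun i : Fin (n * n) => (N.quality i.divNat i.modNat).num) i
  qualityDen i := getD_ofFn (fun i : Fin (n * n) => (N.quality i.divNat i.modNat).den) i

end Input

/-! ### The empirical average is accurate with high probability -/

section Accuracy

variable {n : ℕ} (N : Network (Fin n))

/-- The samples in `l` estimate the expected spread of all seed sets with error at most `δ`. -/
def IsAccurate {M Z : ℕ} (δ : ℝ) (l : Fin M → Fin n → Fin Z) : Prop :=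
  ∀ S, |(∑ t, ((N.intSpread Z (fun u => (l t u : ℕ)) S).card : ℝ)) / M - N.expectedSpread S| ≤ δ

/-- The bias caused by the discretization, with `3 * n + κ` binary digits. -/
theorem cube_div_two_pow_le (n κ : ℕ) :
    (n : ℝ) * (n * (((n : ℝ) + 1) / (2 ^ (3 * n + κ) : ℕ))) ≤ (1 / 2) ^ κ := by
  have h1 : ((n : ℝ) + 1) ≤ 2 ^ n := by exact_mod_cast Nat.lt_two_pow_self
  have h0 : (0 : ℝ) ≤ n := by positivity
  have h2 : (n : ℝ) * (n * ((n : ℝ) + 1)) ≤ 2 ^ (3 * n) := by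
    calc (n : ℝ) * (n * ((n : ℝ) + 1)) ≤ 2 ^ n * (2 ^ n * 2 ^ n) := by
          gcongr <;> linarith
      _ = 2 ^ (3 * n) := by ring
  rw [← mul_div_assoc, ← mul_div_assoc, div_le_iff₀ (by positivity)]
  push_cast
  calc (n : ℝ) * (n * ((n : ℝ) + 1)) ≤ 2 ^ (3 * n) := h2
    _ = (1 / 2) ^ κ * 2 ^ (3 * n + κ) := by
      rw [pow_add, mul_left_comm, ← mul_pow]
      norm_num

/-- A union bound over the `2 ^ n` seed sets. -/
theorem failure_le {n : ℕ} (hn : 0 < n) (c : ℕ) {x : ℝ} (hx : ((c + 2) * n : ℕ) ≤ x) :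
    (2 : ℝ) ^ n * (2 * Real.exp (-x)) ≤ (1 / 2) ^ (c * n) := by
  have h1 : Real.exp (-x) ≤ (1 / 2) ^ ((c + 2) * n) := by
    calc Real.exp (-x) ≤ Real.exp (-(((c + 2) * n : ℕ) : ℝ)) := Real.exp_le_exp.2 (by linarith)
      _ = (Real.exp (-1)) ^ ((c + 2) * n) := by
        rw [← Real.exp_nat_mul, mul_neg_one]
      _ ≤ (1 / 2) ^ ((c + 2) * n) := by
        gcongr
        rw [Real.exp_neg, ← one_div]
        gcongr
        linarith [Real.add_one_le_exp (1 : ℝ)]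
  have h2 : (2 : ℝ) ≤ 2 ^ n := by
    calc (2 : ℝ) = 2 ^ 1 := (pow_one _).symm
      _ ≤ 2 ^ n := pow_le_pow_right₀ one_le_two hn
  calc (2 : ℝ) ^ n * (2 * Real.exp (-x)) ≤ 2 ^ n * (2 ^ n * (1 / 2) ^ ((c + 2) * n)) := by gcongr
    _ = (1 / 2) ^ (c * n) := by
      have h3 : (2 : ℝ) ^ n * (1 / 2) ^ n = 1 := by
        rw [← mul_pow]
        norm_num
      rw [show (c + 2) * n = n + n + c * n by ring, pow_add, pow_add]
      calc (2 : ℝ) ^ n * (2 ^ n * ((1 / 2) ^ n * (1 / 2) ^ n * (1 / 2) ^ (c * n))) =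
            (2 ^ n * (1 / 2) ^ n) * (2 ^ n * (1 / 2) ^ n) * (1 / 2) ^ (c * n) := by ring
        _ = _ := by rw [h3, one_mul, one_mul]

open Classical in
/-- The fraction of accurate families of samples. The spread is at most `n`, so that accuracy
`ε / 4` of the averages means accuracy `ε / (4 * n)` after scaling to `[0, 1]`, which explains the
number `μ * n ^ 3` of samples; another `ε / 4` is left for the bias of the discretization. -/
theorem one_sub_le_card_isAccurate (hn : 0 < n) (c : ℕ) {ε : ℝ} (hε0 : 0 < ε) (hε1 : ε ≤ 1)
    {κ μ : ℕ} (hκ : (1 / 2 : ℝ) ^ κ ≤ ε / 4) (hμ : 64 * ((c : ℝ) + 2) / ε ^ 2 ≤ μ) :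
    1 - (1 / 2 : ℝ) ^ (c * n) ≤
      (univ.filter fun l : Fin (μ * (n * n * n)) → Fin n → Fin (2 ^ (3 * n + κ)) =>
        IsAccurate N (ε / 2) l).card /
        (Fintype.card (Fin n → Fin (2 ^ (3 * n + κ))) : ℝ) ^ (μ * (n * n * n)) := by
  set M := μ * (n * n * n) with hM
  set Z := 2 ^ (3 * n + κ) with hZ
  have hZpos : 0 < Z := Nat.two_pow_pos _
  have : Nonempty (Fin Z) := ⟨⟨0, hZpos⟩⟩
  have hn' : (0 : ℝ) < n := by exact_mod_cast hn
  have hn1 : (1 : ℝ) ≤ n := by exact_mod_cast hn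
  have hμ0 : (0 : ℝ) < μ := lt_of_lt_of_le (by positivity) hμ
  have hMpos : (0 : ℝ) < M := by
    rw [hM]
    push_cast
    positivity
  let X : Finset (Fin n) → (Fin n → Fin Z) → ℝ := fun S x =>
    ((N.intSpread Z (fun u => x u) S).card : ℝ) / n
  have hX0 : ∀ S x, 0 ≤ X S x := fun S x => by positivity
  have hX1 : ∀ S x, X S x ≤ 1 := fun S x => by
    refine (div_le_one hn').2 ?_
    exact_mod_cast (card_le_univ _).trans_eq (Fintype.card_fin n)
  have hδ0 : 0 ≤ ε / (4 * n) := by positivity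
  have hδ1 : ε / (4 * n) ≤ 2 := by
    rw [div_le_iff₀ (by positivity)]
    nlinarith
  have hdev := card_exists_deviation_le hX0 hX1 hδ0 hδ1 M
  rw [Fintype.card_finset, Fintype.card_fin, Nat.cast_pow, Nat.cast_ofNat] at hdev
  have hexp : (((c + 2) * n : ℕ) : ℝ) ≤ M * (ε / (4 * n)) ^ 2 / 4 := by
    have h1 : (M : ℝ) * (ε / (4 * n)) ^ 2 / 4 = μ * ε ^ 2 / 64 * n := by
      rw [hM]
      push_cast
      field_simp
      ring
    rw [h1]
    push_cast
    gcongr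
    rw [div_le_iff₀ (by positivity)] at hμ
    linarith
  have hfail := failure_le hn c hexp
  have hΩ : (0 : ℝ) < (Fintype.card (Fin n → Fin Z) : ℝ) ^ M := by
    have : 0 < Fintype.card (Fin n → Fin Z) := Fintype.card_pos
    positivity
  have hbad := hdev.trans (mul_le_mul_of_nonneg_right hfail hΩ.le)
  set B := univ.filter fun ω : Fin M → Fin n → Fin Z =>
    ∃ S, M * (ε / (4 * n)) <
      |∑ t, X S (ω t) - M * ((∑ x, X S x) / Fintype.card (Fin n → Fin Z))| with hB
  have hgood : Bᶜ ⊆ univ.filter fun l => IsAccurate N (ε / 2) l := by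
    intro l hl
    simp only [hB, mem_compl, mem_filter, mem_univ, true_and, not_exists, not_lt] at hl ⊢
    intro S
    have h1 := hl S
    have h2 := N.abs_average_sub_expectedSpread_le hZpos S
    rw [Fintype.card_fin] at h2
    have h3 := h2.trans ((cube_div_two_pow_le n κ).trans hκ)
    set avg := (∑ x : Fin n → Fin Z, ((N.intSpread Z (fun u => (x u : ℕ)) S).card : ℝ)) /
      Fintype.card (Fin n → Fin Z) with havg
    have h4 : (∑ x, X S x) / Fintype.card (Fin n → Fin Z) = avg / n := by
      simp only [X]
      rw [← sum_div, havg]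
      ring
    have h5 : ∑ t, X S (l t) =
        (∑ t, ((N.intSpread Z (fun u => (l t u : ℕ)) S).card : ℝ)) / n := by
      simp only [X]
      rw [sum_div]
    rw [h4, h5] at h1
    set tot := ∑ t, ((N.intSpread Z (fun u => (l t u : ℕ)) S).card : ℝ)
    have h6 : tot / n - M * (avg / n) = (tot / M - avg) * (M / n) := by
      field_simp
    have h7 : (M : ℝ) * (ε / (4 * n)) = ε / 4 * (M / n) := by
      field_simp
    have hMn : 0 < (M : ℝ) / n := by positivity
    rw [h6, h7, abs_mul, abs_of_pos hMn] at h1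
    have h8 := le_of_mul_le_mul_right h1 hMn
    have := abs_sub_le (tot / M) avg (N.expectedSpread S)
    linarith
  have hcompl : (Bᶜ.card : ℝ) = (Fintype.card (Fin n → Fin Z) : ℝ) ^ M - B.card := by
    rw [card_compl, Nat.cast_sub (card_le_univ B)]
    congr 1
    rw [Fintype.card_fun (α := Fin M)]
    simp
  rw [le_div_iff₀ hΩ]
  have hcard := Nat.cast_le (α := ℝ).2 (card_le_card hgood)
  rw [sub_mul, one_mul]
  linarith

end Accuracy

end SeedSet

theorem mainTheorem6 (ε : ℝ) (hε : 0 < ε) (c : ℕ) :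
    ∃ (P : SeedSet.Prog) (q : Polynomial ℕ),
      ∀ (n k : ℕ) (N : SeedSet.Network (Fin n)), k ≤ n →
        ∀ m : ℕ, m = q.eval (SeedSet.inputSize (SeedSet.encode N k)) →
          (∀ r : Fin m → Bool, ∃ (t : ℕ) (s : SeedSet.Memory),
            SeedSet.Exec P (SeedSet.initialMemory (SeedSet.encode N k) r) t s ∧
              t ≤ m ∧ (SeedSet.outputSet n s).card = k) ∧
          1 - (1 / 2 : ℝ) ^ (c * n) ≤
            (Set.ncard {r : Fin m → Bool | ∃ (t : ℕ) (s : SeedSet.Memory),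
              SeedSet.Exec P (SeedSet.initialMemory (SeedSet.encode N k) r) t s ∧
                ∀ T : Finset (Fin n), T.card ≤ k →
                  (1 - 1 / Real.exp 1 - ε) * N.expectedSpread T ≤
                    N.expectedSpread (SeedSet.outputSet n s)} : ℝ) / 2 ^ m := by
  classical
  set δ := min ε 1 with hδ
  have hδ0 : 0 < δ := lt_min hε one_pos
  obtain ⟨κ, hκ⟩ := exists_pow_lt_of_lt_one (show 0 < δ / 4 by positivity)
    (show (1 / 2 : ℝ) < 1 by norm_num)
  obtain ⟨μ, hμ⟩ := exists_nat_ge (64 * ((c : ℝ) + 2) / δ ^ 2)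
  -- the parameter of the cost bounds; it also bounds the number of random bits that are read
  let p : Polynomial ℕ := .C μ * .X ^ 3 * (.X + 1) + (.C 3 * .X + .C κ) + .C 6 * .X + 2 +
    .C μ * .X ^ 3 * .X * (.C 3 * .X + .C κ)
  refine ⟨SeedSet.Greedy.program κ μ, (SeedSet.Greedy.program κ μ).cost.comp p + p,
    fun n k N hk m hm => ?_⟩
  set L := SeedSet.inputSize (SeedSet.encode N k) with hL
  have hnL : n ≤ L := (SeedSet.fits N k (κ := 0) (M := 0) hL le_rfl).n_le
  set K := p.eval L with hKdef
  have hKeq : K = μ * L ^ 3 * (L + 1) + (3 * L + κ) + 6 * L + 2 + μ * L ^ 3 * L * (3 * L + κ) := by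
    simp [hKdef, p]
  have hn3 : μ * (n * n * n) ≤ μ * L ^ 3 := by
    rw [show n * n * n = n ^ 3 by ring]
    gcongr
  have hfits : SeedSet.Greedy.Fits N κ (μ * (n * n * n)) L K := by
    refine SeedSet.fits N k hL ?_
    rw [hKeq]
    refine le_trans ?_ (Nat.le_add_right _ _)
    gcongr
  have hmK : m = (SeedSet.Greedy.program κ μ).cost.eval K + K := by
    rw [hm, Polynomial.eval_add, Polynomial.eval_comp]
  have hbits : μ * (n * n * n) * n * (3 * n + κ) ≤ m := by
    have : μ * (n * n * n) * n * (3 * n + κ) ≤ μ * L ^ 3 * L * (3 * L + κ) := by gcongr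
    omega
  have hrun : ∀ r : Fin m → Bool, ∃ t s,
      SeedSet.Exec (SeedSet.Greedy.program κ μ)
        (SeedSet.initialMemory (SeedSet.encode N k) r) t s ∧ t ≤ m ∧
      SeedSet.IsGreedy (fun S => 1 + SeedSet.Greedy.totalSpread N (3 * n + κ) (μ * (n * n * n))
        (SeedSet.extendBits r) S) k (SeedSet.outputSet n s) := by
    intro r
    obtain ⟨t, s, he, ht, -, S, hS, hg⟩ := SeedSet.Greedy.runs_program
      (SeedSet.extendBits_le_one r) hfits
      (SeedSet.initial_initialMemory N k r) hk (SeedSet.bounded_initialMemory r _ (by omega))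
    refine ⟨t, s, he, by omega, ?_⟩
    rwa [SeedSet.Greedy.outputSet_eq_of_holds hS]
  refine ⟨fun r => ?_, ?_⟩
  · obtain ⟨t, s, he, ht, hg⟩ := hrun r
    exact ⟨t, s, he, ht, hg.card_eq⟩
  -- for `n = 0` the probability bound is trivial; the concentration argument divides by `n`
  rcases Nat.eq_zero_or_pos n with hn | hn
  · have h0 : 1 - (1 / 2 : ℝ) ^ (c * n) = 0 := by simp [hn]
    rw [h0]
    positivity
  refine (SeedSet.one_sub_le_card_isAccurate N hn c hδ0 (min_le_right _ _) hκ.le hμ).trans ?_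
  rw [← SeedSet.ncard_samples _ _ _ m hbits]
  refine div_le_div_of_nonneg_right (Nat.cast_le.2 (Set.ncard_le_ncard ?_ (Set.toFinite _)))
    (by positivity)
  rintro r ⟨l, hl, hacc⟩
  obtain ⟨t, s, he, -, hg⟩ := hrun r
  refine ⟨t, s, he, fun T hT => ?_⟩
  -- greedy for the integer values computed by the program is greedy for the empirical averages
  have hg' := hg.map (g := fun x : ℕ => ((x : ℝ) - 1) / (μ * (n * n * n) : ℕ)) fun x y hxy => by
    gcongr
  have happ := hg'.approx N.expectedSpread_mono N.expectedSpread_union_add_inter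
    N.card_le_expectedSpread (δ := δ / 2) (fun S => ?_) (by simpa using hk) hT
  · refine le_trans (mul_le_mul_of_nonneg_right ?_ ?_) happ
    · have : δ ≤ ε := min_le_left _ _
      linarith
    · exact le_trans (by positivity) (N.card_le_expectedSpread T)
  · have := hacc S
    simp only [hl] at this
    simpa [SeedSet.Greedy.totalSpread] using this
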